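/- Let $\mathbb K$ be a field, $A$ a $\mathbb K$-vector space (of any dimension) and $\Phi:A\otimes A\to A\otimes A$ a linear map such that $$(\mathrm{Id}\otimes\Phi)\circ(\Phi\otimes\mathrm{Id})\circ(\mathrm{Id}\otimes\Phi)=(\Phi\otimes\mathrm{Id})\circ(\mathrm{Id}\otimes\tau)\circ(\Phi\otimes\mathrm{Id}),$$ where $\tau$ is the flip of $A\otimes A$ (that is, $(A,\Phi)$ is a linear extended associative semigroup). Let $\mathbf{As}_\Phi$ be the nonsymmetric operad of $\Phi$-associative algebras: the quotient of the free nonsymmetric operad generated by $A$ placed in arity $2$ by the operadic ideal generated by the relations $$a\circ_2 b=\sum (a'\rightarrow b')\circ_1 (a''\triangleright b''),\qquad a,b\in A,\quad\text{where } \Phi(a\otimes b)=\sum (a'\rightarrow b')\otimes (a''\triangleright b'').$$ Then there are linear isomorphisms $\mathbf{As}_\Phi(n)\cong A^{\otimes(n-1)}$ for all $n\geqslant 1$, sending the unit to $1\in A^{\otimes 0}=\mathbb K$ and each generator $a\in\mathbf{As}_\Phi(2)$ to $a\in A^{\otimes 1}$, under which the partial compositions are as follows (tensors being written as words). For all $k,l\geqslant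 0$, all $a_k\ldots a_1\in A^{\otimes k}=\mathbf{As}_\Phi(k+1)$, all $b_l\ldots b_1\in A^{\otimes l}=\mathbf{As}_\Phi(l+1)$ and all $1\leqslant i\leqslant k+1$: $$a_k\ldots a_1\circ_i b_l\ldots b_1=\begin{cases} a_k\ldots a_1\,b_l\ldots b_1&\text{if } i=1,\\ a_k\ldots a_i\;\Psi_l(a_{i-1}b_l\ldots b_1)\;a_{i-2}\ldots a_1&\text{if } i\geqslant 2,\end{cases}$$ where $\Psi_l:A^{\otimes(l+1)}\to A^{\otimes(l+1)}$ is the composite of $l$ maps $$\Psi_l=(\mathrm{Id}^{\otimes(l-1)}\otimes\Phi)\circ\cdots\circ(\mathrm{Id}\otimes\Phi\otimes\mathrm{Id}^{\otimes(l-2)})\circ(\Phi\otimes\mathrm{Id}^{\otimes(l-1)}),\qquad \Psi_0=\mathrm{Id}.$$ -/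

import Mathlib

open scoped TensorProduct

universe u v w

/-! ### Nonsymmetric operads over a field, through partial compositions -/

/-- A nonsymmetric operad in `K`-vector spaces, given by its partial compositions.
`circ i hi h x y` is `x ∘_i y`, for `x` of arity `m`, `y` of arity `n` and `1 ≤ i ≤ m`; its arity is
`k = m + n - 1`, which is recorded by the proof `h : k + 1 = m + n` so that the axioms
need no transport between arities. -/
structure NSOperad (K : Type u) [Field K] where
  obj : ℕ → Type w
  [addCommGroup : ∀ n, AddCommGroup (obj n)]
  [module : ∀ n, Module K (obj n)]
  /-- the unit, of arity `1` -/
  one : obj 1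
  /-- the partial compositions -/
  circ : ∀ {m n k : ℕ} (i : ℕ), 1 ≤ i ∧ i ≤ m → k + 1 = m + n →
    obj m →ₗ[K] obj n →ₗ[K] obj k
  one_circ : ∀ {n : ℕ} (hi : 1 ≤ 1 ∧ 1 ≤ 1) (h : n + 1 = 1 + n) (x : obj n),
    circ 1 hi h one x = x
  circ_one : ∀ {n : ℕ} (i : ℕ) (hi : 1 ≤ i ∧ i ≤ n) (h : n + 1 = n + 1) (x : obj n),
    circ i hi h x one = x
  /-- sequential composition: `(x ∘_i y) ∘_{i+j-1} z = x ∘_i (y ∘_j z)` -/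
  seq : ∀ {l m n p q r : ℕ} (i j : ℕ) (hi : 1 ≤ i ∧ i ≤ l) (hj : 1 ≤ j ∧ j ≤ m)
    (hp : p + 1 = l + m) (hq : q + 1 = m + n) (hr : r + 1 = p + n) (hr' : r + 1 = l + q)
    (hij : 1 ≤ i + j - 1 ∧ i + j - 1 ≤ p) (x : obj l) (y : obj m) (z : obj n),
    circ (i + j - 1) hij hr (circ i hi hp x y) z = circ i hi hr' x (circ j hj hq y z)
  /-- parallel composition: `(x ∘_i y) ∘_{j-1+m} z = (x ∘_j z) ∘_i y` for `i < j`,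
  where `m` is the arity of `y` -/
  par : ∀ {l m n p q r : ℕ} (i j : ℕ) (hi : 1 ≤ i ∧ i ≤ l) (hj : 1 ≤ j ∧ j ≤ l) (_ : i < j)
    (hp : p + 1 = l + m) (hq : q + 1 = l + n) (hr : r + 1 = p + n) (hr' : r + 1 = q + m)
    (hjm : 1 ≤ j - 1 + m ∧ j - 1 + m ≤ p) (hi' : 1 ≤ i ∧ i ≤ q)
    (x : obj l) (y : obj m) (z : obj n),
    circ (j - 1 + m) hjm hr (circ i hi hp x y) z = circ i hi' hr' (circ j hj hq x z) y

attribute [instance] NSOperad.addCommGroup NSOperad.module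

namespace NSOperad

variable {K : Type u} [Field K]

/-- An operadic ideal: a family of subspaces stable under all partial compositions with arbitrary
elements of the operad, on either side. -/
structure OperadicIdeal (P : NSOperad.{u, w} K) where
  carrier : ∀ n, Submodule K (P.obj n)
  circ_mem_left : ∀ {m n k : ℕ} (i : ℕ) (hi : 1 ≤ i ∧ i ≤ m) (h : k + 1 = m + n)
    (x : P.obj m) (y : P.obj n), x ∈ carrier m → P.circ i hi h x y ∈ carrier k
  circ_mem_right : ∀ {m n k : ℕ} (i : ℕ) (hi : 1 ≤ i ∧ i ≤ m) (h : k + 1 = m + n)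
    (x : P.obj m) (y : P.obj n), y ∈ carrier n → P.circ i hi h x y ∈ carrier k

/-- The operadic ideal generated by a set of elements `R n` in each arity `n`. -/
def idealSpan (P : NSOperad.{u, w} K) (R : ∀ n, Set (P.obj n)) : P.OperadicIdeal where
  carrier n := ⨅ (I : P.OperadicIdeal) (_ : ∀ m, R m ⊆ I.carrier m), I.carrier n
  circ_mem_left i hi h x y hx := by
    simp only [Submodule.mem_iInf] at hx ⊢
    exact fun I hI => I.circ_mem_left i hi h x y (hx I hI)
  circ_mem_right i hi h x y hy := by
    simp only [Submodule.mem_iInf] at hy ⊢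
    exact fun I hI => I.circ_mem_right i hi h x y (hy I hI)

/-- The partial compositions induced on the quotient by an operadic ideal. -/
def quotCirc (P : NSOperad.{u, w} K) (I : P.OperadicIdeal) {m n k : ℕ} (i : ℕ)
    (hi : 1 ≤ i ∧ i ≤ m) (h : k + 1 = m + n) :
    (P.obj m ⧸ I.carrier m) →ₗ[K] (P.obj n ⧸ I.carrier n) →ₗ[K] (P.obj k ⧸ I.carrier k) :=
  (I.carrier m).liftQ
    { toFun := fun x => (I.carrier n).liftQ ((I.carrier k).mkQ ∘ₗ P.circ i hi h x) (by
        intro y hy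
        simpa using I.circ_mem_right i hi h x y hy)
      map_add' := fun x x' => by
        apply Submodule.linearMap_qext
        ext y
        simp
      map_smul' := fun c x => by
        apply Submodule.linearMap_qext
        ext y
        simp }
    (by
      intro x hx
      rw [LinearMap.mem_ker]
      apply Submodule.linearMap_qext
      ext y
      simpa using I.circ_mem_left i hi h x y hx)

theorem quotCirc_mk (P : NSOperad.{u, w} K) (I : P.OperadicIdeal) {m n k : ℕ} (i : ℕ)
    (hi : 1 ≤ i ∧ i ≤ m) (h : k + 1 = m + n) (x : P.obj m) (y : P.obj n) :
    P.quotCirc I i hi h (Submodule.Quotient.mk x) (Submodule.Quotient.mk y) =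
      Submodule.Quotient.mk (P.circ i hi h x y) :=
  rfl

/-- The quotient of a nonsymmetric operad by an operadic ideal. -/
def quotient (P : NSOperad.{u, w} K) (I : P.OperadicIdeal) : NSOperad.{u, w} K where
  obj n := P.obj n ⧸ I.carrier n
  one := (I.carrier 1).mkQ P.one
  circ i hi h := P.quotCirc I i hi h
  one_circ hi h x := by
    induction x using Submodule.Quotient.induction_on with
    | H x => rw [Submodule.mkQ_apply, quotCirc_mk, P.one_circ]
  circ_one i hi h x := by
    induction x using Submodule.Quotient.induction_on with
    | H x => rw [Submodule.mkQ_apply, quotCirc_mk, P.circ_one]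
  seq i j hi hj hp hq hr hr' hij x y z := by
    induction x using Submodule.Quotient.induction_on with
    | H x =>
      induction y using Submodule.Quotient.induction_on with
      | H y =>
        induction z using Submodule.Quotient.induction_on with
        | H z => simp only [quotCirc_mk, P.seq i j hi hj hp hq hr hr' hij x y z]
  par i j hi hj hlt hp hq hr hr' hjm hi' x y z := by
    induction x using Submodule.Quotient.induction_on with
    | H x =>
      induction y using Submodule.Quotient.induction_on with
      | H y =>
        induction z using Submodule.Quotient.induction_on with
        | H z => simp only [quotCirc_mk, P.par i j hi hj hlt hp hq hr hr' hjm hi' x y z]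

/-- The projection of an operad onto its quotient by an operadic ideal. -/
def quotMk (P : NSOperad.{u, w} K) (I : P.OperadicIdeal) (n : ℕ) :
    P.obj n →ₗ[K] (P.quotient I).obj n :=
  (I.carrier n).mkQ

theorem quotMk_eq_zero (P : NSOperad.{u, w} K) (I : P.OperadicIdeal) {n : ℕ} {x : P.obj n}
    (hx : x ∈ I.carrier n) : P.quotMk I n x = 0 :=
  (Submodule.Quotient.mk_eq_zero _).2 hx

theorem subset_idealSpan (P : NSOperad.{u, w} K) (R : ∀ n, Set (P.obj n)) {n : ℕ} {x : P.obj n}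
    (hx : x ∈ R n) : x ∈ (P.idealSpan R).carrier n := by
  simp only [idealSpan, Submodule.mem_iInf]
  exact fun I hI => hI n hx

end NSOperad

/-! ### Decorated planar binary trees and the free operad on a space of binary operations -/

namespace DecTree

variable {A : Type v}

/-- `graft t i s`: the root of `s` is grafted on the `i`-th leaf of `t`, the leaves being numbered
from left to right, starting with `1`. -/
def graft : BinaryTree A → ℕ → BinaryTree A → BinaryTree A
  | .nil, _, s => s
  | .node a l r, i, s =>
    if i ≤ l.numLeaves then .node a (graft l i s) r
    else .node a l (graft r (i - l.numLeaves) s)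

theorem numLeaves_graft (t : BinaryTree A) (i : ℕ) (s : BinaryTree A) :
    1 ≤ i ∧ i ≤ t.numLeaves →
      (graft t i s).numLeaves + 1 = t.numLeaves + s.numLeaves := by
  induction t generalizing i with
  | nil => intro _; simp [graft, Nat.add_comm]
  | node a l r ihl ihr =>
    intro h
    simp only [BinaryTree.numLeaves] at h
    by_cases hi : i ≤ l.numLeaves
    · have := ihl i ⟨h.1, hi⟩
      simp only [graft, if_pos hi, BinaryTree.numLeaves]
      omega
    · have := ihr (i - l.numLeaves) (by omega)
      simp only [graft, if_neg hi, BinaryTree.numLeaves]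
      omega

theorem graft_nil (t : BinaryTree A) (i : ℕ) : graft t i .nil = t := by
  induction t generalizing i with
  | nil => rfl
  | node a l r ihl ihr => simp [graft, ihl, ihr]

theorem graft_seq (x y z : BinaryTree A) (i j : ℕ) (hi : 1 ≤ i ∧ i ≤ x.numLeaves)
    (hj : 1 ≤ j ∧ j ≤ y.numLeaves) :
    graft (graft x i y) (i + j - 1) z = graft x i (graft y j z) := by
  induction x generalizing i with
  | nil =>
    simp only [BinaryTree.numLeaves] at hi
    have : i + j - 1 = j := by omega
    simp [graft, this]
  | node a l r ihl ihr =>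
    simp only [BinaryTree.numLeaves] at hi
    by_cases h : i ≤ l.numLeaves
    · have hn := numLeaves_graft l i y ⟨hi.1, h⟩
      have h2 : i + j - 1 ≤ (graft l i y).numLeaves := by omega
      simp only [graft, if_pos h, if_pos h2, ihl i ⟨hi.1, h⟩]
    · have h2 : ¬ i + j - 1 ≤ l.numLeaves := by omega
      have h3 : i + j - 1 - l.numLeaves = i - l.numLeaves + j - 1 := by omega
      simp only [graft, if_neg h, if_neg h2, h3, ihr (i - l.numLeaves) (by omega)]

theorem graft_par (x y z : BinaryTree A) (i j : ℕ) (hi : 1 ≤ i) (hij : i < j)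
    (hj : j ≤ x.numLeaves) :
    graft (graft x i y) (j - 1 + y.numLeaves) z = graft (graft x j z) i y := by
  have pos : ∀ t : BinaryTree A, 1 ≤ t.numLeaves := fun t => by
    rw [BinaryTree.numLeaves_eq_numNodes_succ]; omega
  induction x generalizing i j with
  | nil => simp only [BinaryTree.numLeaves] at hj; omega
  | node a l r ihl ihr =>
    simp only [BinaryTree.numLeaves] at hj
    have hy := pos y
    by_cases h : j ≤ l.numLeaves
    · have hil : i ≤ l.numLeaves := by omega
      have hn := numLeaves_graft l i y ⟨hi, hil⟩
      have hn' := numLeaves_graft l j z ⟨by omega, h⟩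
      have hz := pos z
      have h2 : j - 1 + y.numLeaves ≤ (graft l i y).numLeaves := by omega
      have h3 : i ≤ (graft l j z).numLeaves := by omega
      simp only [graft, if_pos h, if_pos hil, if_pos h2, if_pos h3, ihl i j hi hij h]
    · by_cases hil : i ≤ l.numLeaves
      · have hn := numLeaves_graft l i y ⟨hi, hil⟩
        have h2 : ¬ j - 1 + y.numLeaves ≤ (graft l i y).numLeaves := by omega
        have h3 : j - 1 + y.numLeaves - (graft l i y).numLeaves = j - l.numLeaves := by omega
        simp only [graft, if_neg h, if_pos hil, if_neg h2, h3]
      · have h2 : ¬ j - 1 + y.numLeaves ≤ l.numLeaves := by omega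
        have h3 : j - 1 + y.numLeaves - l.numLeaves = j - l.numLeaves - 1 + y.numLeaves := by
          omega
        simp only [graft, if_neg h, if_neg hil, if_neg h2, h3,
          ihr (i - l.numLeaves) (j - l.numLeaves) (by omega) (by omega) (by omega)]

/-- Planar binary trees with `n` leaves whose internal vertices are decorated by `A`. -/
def Trees (A : Type v) (n : ℕ) : Type v := {t : BinaryTree A // t.numLeaves = n}

/-- The tree without internal vertex. -/
def Trees.nil : Trees A 1 := ⟨.nil, rfl⟩

/-- The tree with one internal vertex, decorated by `a`. -/
def Trees.corolla (a : A) : Trees A 2 := ⟨.node a .nil .nil, rfl⟩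

/-- Grafting of trees with prescribed numbers of leaves. -/
def Trees.graft {m n k : ℕ} (i : ℕ) (hi : 1 ≤ i ∧ i ≤ m) (h : k + 1 = m + n)
    (t : Trees A m) (s : Trees A n) : Trees A k :=
  ⟨DecTree.graft t.1 i s.1, by
    have := numLeaves_graft t.1 i s.1 (by rw [t.2]; exact hi)
    rw [t.2, s.2] at this
    omega⟩

/-- Bilinear extension of grafting to linear combinations of trees. -/
noncomputable def linGraft (K : Type u) [Field K] {m n k : ℕ} (i : ℕ) (hi : 1 ≤ i ∧ i ≤ m)
    (h : k + 1 = m + n) :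
    (Trees A m →₀ K) →ₗ[K] (Trees A n →₀ K) →ₗ[K] (Trees A k →₀ K) :=
  Finsupp.linearCombination K fun t : Trees A m =>
    Finsupp.linearCombination K fun s : Trees A n =>
      Finsupp.single (Trees.graft i hi h t s) (1 : K)

theorem linGraft_single (K : Type u) [Field K] {m n k : ℕ} (i : ℕ) (hi : 1 ≤ i ∧ i ≤ m)
    (h : k + 1 = m + n) (t : Trees A m) (s : Trees A n) (c d : K) :
    linGraft K i hi h (Finsupp.single t c) (Finsupp.single s d) =
      Finsupp.single (Trees.graft i hi h t s) (c * d) := by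
  simp [linGraft, Finsupp.linearCombination_single]

/-- The operad of formal `K`-linear combinations of planar binary trees decorated by the set `A`:
the free nonsymmetric operad generated by the set `A` of binary operations. -/
noncomputable def treeOperad (K : Type u) [Field K] (A : Type v) : NSOperad.{u, max u v} K where
  obj n := Trees A n →₀ K
  one := Finsupp.single Trees.nil 1
  circ i hi h := linGraft K i hi h
  one_circ {n} hi h x := by
    induction x using Finsupp.induction_linear with
    | zero => simp
    | add x y hx hy => rw [map_add, hx, hy]
    | single t c =>
      rw [linGraft_single, one_mul]
      rfl
  circ_one {n} i hi h x := by
    induction x using Finsupp.induction_linear with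
    | zero => simp
    | add x y hx hy => rw [map_add, LinearMap.add_apply, hx, hy]
    | single t c =>
      rw [linGraft_single, mul_one]
      congr 1
      exact Subtype.ext (graft_nil t.1 i)
  seq i j hi hj hp hq hr hr' hij x y z := by
    induction x using Finsupp.induction_linear with
    | zero => simp
    | add x x' hx hx' => simp only [map_add, LinearMap.add_apply, hx, hx']
    | single t c =>
      induction y using Finsupp.induction_linear with
      | zero => simp
      | add y y' hy hy' => simp only [map_add, LinearMap.add_apply, hy, hy']
      | single s d =>
        induction z using Finsupp.induction_linear with
        | zero => simp
        | add z z' hz hz' => simp only [map_add, hz, hz']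
        | single r e =>
          simp only [linGraft_single, mul_assoc]
          congr 1
          exact Subtype.ext (graft_seq t.1 s.1 r.1 i j (by rw [t.2]; exact hi)
            (by rw [s.2]; exact hj))
  par i j hi hj hlt hp hq hr hr' hjm hi' x y z := by
    induction x using Finsupp.induction_linear with
    | zero => simp
    | add x x' hx hx' => simp only [map_add, LinearMap.add_apply, hx, hx']
    | single t c =>
      induction y using Finsupp.induction_linear with
      | zero => simp
      | add y y' hy hy' => simp only [map_add, LinearMap.add_apply, hy, hy']
      | single s d =>
        induction z using Finsupp.induction_linear with
        | zero => simp
        | add z z' hz hz' => simp only [map_add, LinearMap.add_apply, hz, hz']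
        | single r e =>
          simp only [linGraft_single, mul_right_comm c d e]
          congr 1
          refine Subtype.ext ?_
          have := graft_par t.1 s.1 r.1 i j hi.1 hlt (by rw [t.2]; exact hj.2)
          rw [s.2] at this
          exact this

/-- The tree with one internal vertex, decorated by `a`, as an operation of arity `2`. -/
noncomputable def corolla (K : Type u) [Field K] (a : A) : (treeOperad K A).obj 2 :=
  Finsupp.single (Trees.corolla a) (1 : K)

/-- Linearity of the corollas in their decoration. -/
inductive LinearityRel (K : Type u) [Field K] (A : Type v) [AddCommGroup A] [Module K A] :
    ∀ n, (treeOperad K A).obj n → Prop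
  | add (a b : A) : LinearityRel K A 2 (corolla K (a + b) - corolla K a - corolla K b)
  | smul (c : K) (a : A) : LinearityRel K A 2 (corolla K (c • a) - c • corolla K a)

/-- The operadic ideal generated by the linearity relations. -/
noncomputable def linearityIdeal (K : Type u) [Field K] (A : Type v) [AddCommGroup A] [Module K A] :
    (treeOperad K A).OperadicIdeal :=
  (treeOperad K A).idealSpan fun n => {x | LinearityRel K A n x}

/-- The free nonsymmetric operad `F_A` generated by a vector space `A` of operations of arity `2`:
planar binary trees with vertices decorated by elements of `A`, modulo linearity in
the decoration of each vertex. -/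
noncomputable def freeOperad (K : Type u) [Field K] (A : Type v) [AddCommGroup A] [Module K A] :
    NSOperad.{u, max u v} K :=
  (treeOperad K A).quotient (linearityIdeal K A)

/-- The class in `F_A(n)` of a linear combination of decorated trees. -/
noncomputable def freeMk (K : Type u) [Field K] (A : Type v) [AddCommGroup A] [Module K A] (n : ℕ) :
    (treeOperad K A).obj n →ₗ[K] (freeOperad K A).obj n :=
  (treeOperad K A).quotMk (linearityIdeal K A) n

/-- The inclusion of the generators `A → F_A(2)`. -/
noncomputable def freeGen (K : Type u) [Field K] (A : Type v) [AddCommGroup A] [Module K A] :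
    A →ₗ[K] (freeOperad K A).obj 2 where
  toFun a := freeMk K A 2 (corolla K a)
  map_add' a b := by
    rw [← map_add, ← sub_eq_zero, ← map_sub, ← sub_sub]
    exact NSOperad.quotMk_eq_zero _ _
      (NSOperad.subset_idealSpan _ _ (LinearityRel.add a b))
  map_smul' c a := by
    rw [RingHom.id_apply, ← map_smul, ← sub_eq_zero, ← map_sub]
    exact NSOperad.quotMk_eq_zero _ _
      (NSOperad.subset_idealSpan _ _ (LinearityRel.smul c a))

end DecTree

/-! ### Linear extended associative semigroups and their operads -/

namespace PhiAssoc

variable {K : Type u} [Field K] {A : Type v} [AddCommGroup A] [Module K A]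

/-- `Φ ⊗ Id`, as an endomorphism of `A ⊗ (A ⊗ A)`. -/
noncomputable def tensorId (Φ : A ⊗[K] A →ₗ[K] A ⊗[K] A) :
    A ⊗[K] (A ⊗[K] A) →ₗ[K] A ⊗[K] (A ⊗[K] A) :=
  (TensorProduct.assoc K A A A).toLinearMap ∘ₗ Φ.rTensor A ∘ₗ
    (TensorProduct.assoc K A A A).symm.toLinearMap

/-- `(A, Φ)` is a linear extended associative semigroup:
`(Id ⊗ Φ) ∘ (Φ ⊗ Id) ∘ (Id ⊗ Φ) = (Φ ⊗ Id) ∘ (Id ⊗ τ) ∘ (Φ ⊗ Id)`, with `τ` the flip. -/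
def IsLinearEAS (Φ : A ⊗[K] A →ₗ[K] A ⊗[K] A) : Prop :=
  Φ.lTensor A ∘ₗ tensorId Φ ∘ₗ Φ.lTensor A =
    tensorId Φ ∘ₗ (TensorProduct.comm K A A).toLinearMap.lTensor A ∘ₗ tensorId Φ

/-- The linear map `A ⊗ A → F_A(3)`, `a ⊗ b ↦ a ∘₁ b`. -/
noncomputable def freeCircOne (K : Type u) [Field K] (A : Type v) [AddCommGroup A] [Module K A] :
    A ⊗[K] A →ₗ[K] (DecTree.freeOperad K A).obj 3 :=
  TensorProduct.lift
    (((DecTree.freeOperad K A).circ (m := 2) (n := 2) (k := 3) 1 (by decide) rfl).compl₁₂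
      (DecTree.freeGen K A) (DecTree.freeGen K A))

/-- The relations `a ∘₂ b = ∑ (a' → b') ∘₁ (a'' ▷ b'')`, where `Φ (a ⊗ b) = ∑ a' → b' ⊗ a'' ▷ b''`. -/
inductive AssocRel (Φ : A ⊗[K] A →ₗ[K] A ⊗[K] A) : ∀ n, (DecTree.freeOperad K A).obj n → Prop
  | rel (a b : A) : AssocRel Φ 3
      ((DecTree.freeOperad K A).circ (m := 2) (n := 2) (k := 3) 2 (by decide) rfl
          (DecTree.freeGen K A a) (DecTree.freeGen K A b)
        - freeCircOne K A (Φ (a ⊗ₜ[K] b)))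

/-- The operadic ideal of `F_A` generated by the relations of `Φ`-associativity. -/
noncomputable def assocIdeal (Φ : A ⊗[K] A →ₗ[K] A ⊗[K] A) : (DecTree.freeOperad K A).OperadicIdeal :=
  (DecTree.freeOperad K A).idealSpan fun n => {x | AssocRel Φ n x}

/-- The nonsymmetric operad `As_Φ` of `Φ`-associative algebras: the quotient of the free operad
`F_A` by the operadic ideal generated by the relations of `Φ`-associativity. -/
noncomputable def As (Φ : A ⊗[K] A →ₗ[K] A ⊗[K] A) : NSOperad.{u, max u v} K :=
  (DecTree.freeOperad K A).quotient (assocIdeal Φ)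

/-- The projection `F_A(n) → As_Φ(n)`. -/
noncomputable def As.mk (Φ : A ⊗[K] A →ₗ[K] A ⊗[K] A) (n : ℕ) :
    (DecTree.freeOperad K A).obj n →ₗ[K] (As Φ).obj n :=
  (DecTree.freeOperad K A).quotMk (assocIdeal Φ) n

/-- The generators `A → As_Φ(2)`. -/
noncomputable def As.gen (Φ : A ⊗[K] A →ₗ[K] A ⊗[K] A) : A →ₗ[K] (As Φ).obj 2 :=
  As.mk Φ 2 ∘ₗ DecTree.freeGen K A

/-! ### Words: tensor powers of `A` -/

/-- Concatenation `A^{⊗m} × A^{⊗n} → A^{⊗(m+n)}`. -/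
noncomputable def conc {m n : ℕ} (x : ⨂[K]^m A) (y : ⨂[K]^n A) : ⨂[K]^(m + n) A :=
  TensorPower.mulEquiv (x ⊗ₜ[K] y)

/-- The word with one letter `a`. -/
noncomputable def letter (K : Type u) [Field K] {A : Type v} [AddCommGroup A] [Module K A]
    (a : A) : ⨂[K]^1 A :=
  PiTensorProduct.tprod K fun _ => a

/-- The identification of `A ⊗ A` with the tensor power `A^{⊗2}`. -/
noncomputable def squareEquiv (K : Type u) [Field K] (A : Type v) [AddCommGroup A] [Module K A] :
    A ⊗[K] A ≃ₗ[K] ⨂[K]^2 A :=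
  (TensorProduct.congr (PiTensorProduct.subsingletonEquiv (R := K) (s := fun _ : Fin 1 => A) 0).symm
    (PiTensorProduct.subsingletonEquiv (R := K) (s := fun _ : Fin 1 => A) 0).symm).trans
    (TensorPower.mulEquiv (n := 1) (m := 1))

/-- `f ⊗ g` on tensor powers. -/
noncomputable def powMap {m n : ℕ} (f : ⨂[K]^m A →ₗ[K] ⨂[K]^m A) (g : ⨂[K]^n A →ₗ[K] ⨂[K]^n A) :
    ⨂[K]^(m + n) A →ₗ[K] ⨂[K]^(m + n) A :=
  TensorPower.mulEquiv.toLinearMap ∘ₗ TensorProduct.map f g ∘ₗ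
    TensorPower.mulEquiv.symm.toLinearMap

/-- `Id^{⊗p} ⊗ Φ ⊗ Id^{⊗q}` on `A^{⊗n}`, where `n = p + 2 + q`. -/
noncomputable def phiAt (Φ : A ⊗[K] A →ₗ[K] A ⊗[K] A) {n : ℕ} (p q : ℕ) (h : p + 2 + q = n) :
    ⨂[K]^n A →ₗ[K] ⨂[K]^n A :=
  (TensorPower.cast K A h).toLinearMap ∘ₗ
    powMap (powMap (LinearMap.id : ⨂[K]^p A →ₗ[K] ⨂[K]^p A)
      ((squareEquiv K A).toLinearMap ∘ₗ Φ ∘ₗ (squareEquiv K A).symm.toLinearMap))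
      (LinearMap.id : ⨂[K]^q A →ₗ[K] ⨂[K]^q A) ∘ₗ
    (TensorPower.cast K A h).symm.toLinearMap

/-- The composite of the first `t` factors (from the right) of
`(Id^{⊗(l-1)} ⊗ Φ) ∘ ⋯ ∘ (Id ⊗ Φ ⊗ Id^{⊗(l-2)}) ∘ (Φ ⊗ Id^{⊗(l-1)})`. -/
noncomputable def sweepAux (Φ : A ⊗[K] A →ₗ[K] A ⊗[K] A) (l : ℕ) :
    ∀ t : ℕ, t ≤ l → (⨂[K]^(1 + l) A →ₗ[K] ⨂[K]^(1 + l) A)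
  | 0, _ => LinearMap.id
  | t + 1, ht => phiAt Φ t (l - 1 - t) (by omega) ∘ₗ sweepAux Φ l t (by omega)

/-- The endomorphism
`(Id^{⊗(l-1)} ⊗ Φ) ∘ ⋯ ∘ (Id ⊗ Φ ⊗ Id^{⊗(l-2)}) ∘ (Φ ⊗ Id^{⊗(l-1)})` of `A^{⊗(1+l)}`,
a composite of `l` factors, the identity if `l = 0`. -/
noncomputable def sweep (Φ : A ⊗[K] A →ₗ[K] A ⊗[K] A) (l : ℕ) :
    ⨂[K]^(1 + l) A →ₗ[K] ⨂[K]^(1 + l) A :=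
  sweepAux Φ l l le_rfl

end PhiAssoc

/-! ### Moving a letter through a word, in the tensor algebra -/

namespace PhiAssoc

variable {K : Type u} [Field K] {A : Type v} [AddCommGroup A] [Module K A]

open TensorAlgebra (ι)

/-! Read from left to right, the relation a ∘₂ b = ∑ (a' → b') ∘₁ (a'' ▷ b'') turns every tree into
a combination of left combs, and a left comb is a word. So combs span `As Φ`, and the point is that
no further relation between combs is forced.

To prove this, each tree is given a normal form in the tensor algebra. A node with decoration a,
left subtree l and right subtree r evaluates to Ψ(a · r) · l, where Ψ moves a through the word of r
by repeated use of Φ (`insert`). Grafting becomes an explicit operation on words, `splice`; this is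
`evalTree_graft`. Its substance is `insert_splice`, which rests on `pass_insert`: moving a through
Ψ(b y) amounts to applying Φ to a ⊗ b and then forming Ψ of the first output with y. The extended
semigroup identity is used exactly there.

No operad structure on words has to be verified: the kernel of evaluation is an ideal because
evaluation turns compositions into a bilinear operation, and it contains the generating relations.
Evaluation therefore descends to `asEval` on `As Φ`. In the other direction `comb` sends tensors
onto `As Φ` (`comb_surjective`), and `asEval` after `comb` is the injective inclusion of a tensor
power in the tensor algebra (`asEval_comb`). Hence `comb` is bijective, and the composition formulas
are read off from `splice`. -/

/-- Induction on words, adding letters on the left. -/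
theorem word_induction_left {P : TensorAlgebra K A → Prop} (one : P 1)
    (add : ∀ x y, P x → P y → P (x + y)) (smul : ∀ (r : K) x, P x → P (r • x))
    (cons : ∀ (a : A) w, P w → P (ι K a * w)) (w : TensorAlgebra K A) : P w := by
  -- Quantifying over a right factor s turns the product case into associativity followed by two
  -- applications of the hypotheses.
  suffices H : ∀ w : TensorAlgebra K A, ∀ s, P s → P (w * s) by simpa using H w 1 one
  intro w
  induction w using TensorAlgebra.induction with
  | algebraMap r =>
    intro s hs
    rw [← Algebra.smul_def]
    exact smul r s hs
  | ι a => exact fun s hs => cons a s hs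
  | mul x y hx hy => exact fun s hs => by rw [mul_assoc]; exact hx _ (hy s hs)
  | add x y hx hy => exact fun s hs => by rw [add_mul]; exact add _ _ (hx s hs) (hy s hs)

/-- The right action of the tensor algebra determined by operators indexed by the letters. -/
noncomputable def rightAction {E : Type w} [AddCommGroup E] [Module K E]
    (R : A →ₗ[K] Module.End K E) : TensorAlgebra K A →ₗ[K] Module.End K E :=
  (MulOpposite.opLinearEquiv K).symm.toLinearMap ∘ₗ
    (TensorAlgebra.lift K ((MulOpposite.opLinearEquiv K).toLinearMap ∘ₗ R)).toLinearMap

section rightAction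

variable {E : Type w} [AddCommGroup E] [Module K E] (R : A →ₗ[K] Module.End K E)

@[simp]
theorem rightAction_one : rightAction R 1 = 1 := by simp [rightAction]

@[simp]
theorem rightAction_ι (a : A) : rightAction R (ι K a) = R a := by simp [rightAction]

theorem rightAction_mul (x y : TensorAlgebra K A) :
    rightAction R (x * y) = rightAction R y * rightAction R x := by simp [rightAction]

theorem rightAction_mul_apply (x y : TensorAlgebra K A) (z : E) :
    rightAction R (x * y) z = rightAction R y (rightAction R x z) := by
  rw [rightAction_mul, Module.End.mul_apply]

end rightAction

/-- The map `t ⊗ a ↦ t * f a`. -/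
noncomputable def mulMap (f : A →ₗ[K] TensorAlgebra K A) :
    TensorAlgebra K A ⊗[K] A →ₗ[K] TensorAlgebra K A :=
  TensorProduct.lift ((LinearMap.mul K (TensorAlgebra K A)).compl₂ f)

@[simp]
theorem mulMap_tmul (f : A →ₗ[K] TensorAlgebra K A) (t : TensorAlgebra K A) (a : A) :
    mulMap f (t ⊗ₜ a) = t * f a := by simp [mulMap]

/-- The map `t ⊗ (c ⊗ d) ↦ (t * f c) ⊗ d`. -/
noncomputable def mulMapLeft (f : A →ₗ[K] TensorAlgebra K A) :
    TensorAlgebra K A ⊗[K] (A ⊗[K] A) →ₗ[K] TensorAlgebra K A ⊗[K] A :=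
  (mulMap f).rTensor A ∘ₗ (TensorProduct.assoc K _ A A).symm.toLinearMap

@[simp]
theorem mulMapLeft_tmul (f : A →ₗ[K] TensorAlgebra K A) (t : TensorAlgebra K A) (c d : A) :
    mulMapLeft f (t ⊗ₜ (c ⊗ₜ d)) = (t * f c) ⊗ₜ d := by simp [mulMapLeft]

theorem mulMapLeft_add (f g : A →ₗ[K] TensorAlgebra K A) :
    mulMapLeft (f + g) = mulMapLeft f + mulMapLeft g := by
  ext; simp [mul_add, TensorProduct.add_tmul]

theorem mulMapLeft_smul (r : K) (f : A →ₗ[K] TensorAlgebra K A) :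
    mulMapLeft (r • f) = r • mulMapLeft f := by
  ext; simp [TensorProduct.smul_tmul']

/-- Left multiplication by `u` on `T(A) ⊗ A`. -/
noncomputable def leftMul (u : TensorAlgebra K A) :
    TensorAlgebra K A ⊗[K] A →ₗ[K] TensorAlgebra K A ⊗[K] A :=
  (LinearMap.mulLeft K u).rTensor A

@[simp]
theorem leftMul_tmul (u t : TensorAlgebra K A) (a : A) :
    leftMul u (t ⊗ₜ[K] a) = (u * t) ⊗ₜ a := by simp [leftMul]

theorem mulMap_leftMul (f : A →ₗ[K] TensorAlgebra K A) (u : TensorAlgebra K A)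
    (z : TensorAlgebra K A ⊗[K] A) : mulMap f (leftMul u z) = u * mulMap f z := by
  induction z using TensorProduct.induction_on with
  | zero => simp
  | tmul t a => simp [mul_assoc]
  | add x y hx hy => simp only [map_add, hx, hy, mul_add]

theorem mulMapLeft_mul_tmul (f : A →ₗ[K] TensorAlgebra K A) (u t : TensorAlgebra K A)
    (z : A ⊗[K] A) : mulMapLeft f ((u * t) ⊗ₜ z) = leftMul u (mulMapLeft f (t ⊗ₜ z)) := by
  induction z using TensorProduct.induction_on with
  | zero => simp
  | tmul t a => simp [mul_assoc]
  | add x y hx hy => simp only [TensorProduct.tmul_add, map_add, hx, hy]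

/-! #### Removing the last letter -/

/-- The pair `(t * a, t ⊗ a)`. -/
noncomputable def snoc (K : Type u) [Field K] (A : Type v) [AddCommGroup A] [Module K A] :
    TensorAlgebra K A →ₗ[K] A →ₗ[K] TensorAlgebra K A × TensorAlgebra K A ⊗[K] A :=
  LinearMap.mk₂ K (fun t a => (t * ι K a, t ⊗ₜ a) :
      TensorAlgebra K A → A → TensorAlgebra K A × TensorAlgebra K A ⊗[K] A)
    (fun _ _ _ => by simp [add_mul, TensorProduct.add_tmul])
    (fun _ _ _ => by simp [TensorProduct.smul_tmul'])
    (fun _ _ _ => by simp [mul_add, TensorProduct.tmul_add])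
    (fun _ _ _ => by simp)

@[simp]
theorem snoc_apply (t : TensorAlgebra K A) (a : A) :
    snoc K A t a = (t * ι K a, t ⊗ₜ a) := rfl

/-- The linear map `T(A) → T(A) ⊗ A` which splits off the last letter, and vanishes on scalars. -/
noncomputable def splitLast (K : Type u) [Field K] (A : Type v) [AddCommGroup A] [Module K A] :
    TensorAlgebra K A →ₗ[K] TensorAlgebra K A ⊗[K] A :=
  LinearMap.snd K _ _ ∘ₗ LinearMap.applyₗ (1, 0) ∘ₗ
    rightAction ((LinearMap.lcomp K _ (LinearMap.fst K _ _)) ∘ₗ (snoc K A).flip)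

/-- In the action defining `splitLast`, a letter a sends (s, z) to (s a, s ⊗ a): the first component
accumulates the word read so far and the second remembers only the last step. No basis of A is
needed. -/
theorem splitLast_mul_ι (t : TensorAlgebra K A) (a : A) :
    splitLast K A (t * ι K a) = t ⊗ₜ a := by
  have key : ∀ t : TensorAlgebra K A, ∀ s z,
      (rightAction ((LinearMap.lcomp K _ (LinearMap.fst K _ _)) ∘ₗ (snoc K A).flip) t (s, z)).1
        = s * t := by
    intro t
    induction t using TensorAlgebra.induction with
    | algebraMap r =>
      intro s z
      rw [Algebra.algebraMap_eq_smul_one]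
      simp
    | ι a => intro s z; simp
    | mul x y hx hy =>
      intro s z
      rw [rightAction_mul_apply]
      rw [← Prod.mk.eta (p := rightAction _ x (s, z)), hy, hx, mul_assoc]
    | add x y hx hy =>
      intro s z
      simp only [map_add, LinearMap.add_apply, Prod.fst_add, hx, hy, mul_add]
  have h := key t 1 0
  simp only [splitLast, LinearMap.comp_apply, LinearMap.applyₗ_apply_apply, rightAction_mul_apply,
    rightAction_ι]
  simp only [one_mul] at h
  simp [h]

theorem splitLast_mulMap (z : TensorAlgebra K A ⊗[K] A) :
    splitLast K A (mulMap (ι K) z) = z := by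
  induction z using TensorProduct.induction_on with
  | zero => simp
  | tmul t a => rw [mulMap_tmul, splitLast_mul_ι]
  | add x y hx hy => simp only [map_add, hx, hy]

/-! #### Moving a letter -/

variable (Φ : A ⊗[K] A →ₗ[K] A ⊗[K] A)

/-- The operator `t ⊗ a ↦ (t * (a' → b')) ⊗ (a'' ▷ b'')` on `T(A) ⊗ A`. -/
noncomputable def passLetter : A →ₗ[K] Module.End K (TensorAlgebra K A ⊗[K] A) where
  toFun b := mulMapLeft (ι K) ∘ₗ (Φ ∘ₗ (TensorProduct.mk K A A).flip b).lTensor _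
  map_add' b c := by ext; simp [TensorProduct.tmul_add]
  map_smul' r b := by ext; simp

theorem passLetter_tmul (b : A) (t : TensorAlgebra K A) (a : A) :
    passLetter Φ b (t ⊗ₜ a) = mulMapLeft (ι K) (t ⊗ₜ Φ (a ⊗ₜ b)) := by simp [passLetter]

/-- Moving the last letter through a word. -/
noncomputable def pass : TensorAlgebra K A →ₗ[K] Module.End K (TensorAlgebra K A ⊗[K] A) :=
  rightAction (passLetter Φ)

@[simp]
theorem pass_one (z : TensorAlgebra K A ⊗[K] A) : pass Φ 1 z = z := by simp [pass]

theorem pass_ι_tmul (b : A) (t : TensorAlgebra K A) (a : A) :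
    pass Φ (ι K b) (t ⊗ₜ a) = mulMapLeft (ι K) (t ⊗ₜ Φ (a ⊗ₜ b)) := by
  simp [pass, passLetter_tmul]

theorem pass_mul (x y : TensorAlgebra K A) (z : TensorAlgebra K A ⊗[K] A) :
    pass Φ (x * y) z = pass Φ y (pass Φ x z) := rightAction_mul_apply _ x y z

/-- The moving letter only meets what is on its right, so the word already on its left is inert. -/
theorem pass_leftMul (y u : TensorAlgebra K A) (z : TensorAlgebra K A ⊗[K] A) :
    pass Φ y (leftMul u z) = leftMul u (pass Φ y z) := by
  induction y using TensorAlgebra.induction generalizing z with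
  | algebraMap r => rw [Algebra.algebraMap_eq_smul_one]; simp
  | ι b =>
    induction z using TensorProduct.induction_on with
    | zero => simp
    | tmul t a => rw [leftMul_tmul, pass_ι_tmul, pass_ι_tmul, mulMapLeft_mul_tmul]
    | add x y hx hy => simp only [map_add, hx, hy]
  | mul x y hx hy => rw [pass_mul, pass_mul, hx, hy]
  | add x y hx hy => simp only [map_add, LinearMap.add_apply, hx, hy]

theorem pass_tmul (y t : TensorAlgebra K A) (a : A) :
    pass Φ y (t ⊗ₜ a) = leftMul t (pass Φ y (1 ⊗ₜ a)) := by
  rw [← pass_leftMul, leftMul_tmul, mul_one]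

/-- The map `Ψ`: `insert Φ y a = Ψ (a y)`, where `y` is a word. -/
noncomputable def insert : TensorAlgebra K A →ₗ[K] A →ₗ[K] TensorAlgebra K A where
  toFun y := mulMap (ι K) ∘ₗ pass Φ y ∘ₗ TensorProduct.mk K _ A 1
  map_add' x y := by ext; simp
  map_smul' r x := by ext; simp

theorem insert_apply (y : TensorAlgebra K A) (a : A) :
    insert Φ y a = mulMap (ι K) (pass Φ y (1 ⊗ₜ a)) := rfl

theorem insert_one : insert Φ 1 = ι K := by
  ext a; simp [insert_apply]

/-- Lets a journey through a product be cut in two: after the first factor, the rest is `insert`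
applied to the letter still moving. -/
theorem mulMap_pass (y : TensorAlgebra K A) (z : TensorAlgebra K A ⊗[K] A) :
    mulMap (ι K) (pass Φ y z) = mulMap (insert Φ y) z := by
  induction z using TensorProduct.induction_on with
  | zero => simp
  | tmul t a => rw [pass_tmul, mulMap_leftMul, mulMap_tmul, insert_apply]
  | add x y hx hy => simp only [map_add, hx, hy]

/-- `insert Φ (c y) b`, as a function of `Φ (b ⊗ c)`. -/
noncomputable def insertStep (y : TensorAlgebra K A) : A ⊗[K] A →ₗ[K] TensorAlgebra K A :=
  mulMap (insert Φ y) ∘ₗ (ι K).rTensor A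

@[simp]
theorem insertStep_tmul (y : TensorAlgebra K A) (p q : A) :
    insertStep Φ y (p ⊗ₜ q) = ι K p * insert Φ y q := by simp [insertStep]

/-- The recursion Ψ(b c y) = ∑ (b' → c') Ψ((b'' ▷ c'') y), peeling off the first crossing. -/
theorem insert_ι_mul (c b : A) (y : TensorAlgebra K A) :
    insert Φ (ι K c * y) b = insertStep Φ y (Φ (b ⊗ₜ c)) := by
  rw [insert_apply, pass_mul, pass_ι_tmul, mulMap_pass]
  generalize Φ (b ⊗ₜ c) = z
  induction z using TensorProduct.induction_on with
  | zero => simp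
  | tmul p q => simp
  | add x y hx hy => simp only [map_add, TensorProduct.tmul_add, hx, hy]

/-- The map `p ⊗ (q ⊗ r) ↦ (t * p * insert Φ y q) ⊗ r`. -/
noncomputable def threeStrands (t y : TensorAlgebra K A) :
    A ⊗[K] (A ⊗[K] A) →ₗ[K] TensorAlgebra K A ⊗[K] A :=
  leftMul t ∘ₗ mulMapLeft (insert Φ y) ∘ₗ (ι K).rTensor (A ⊗[K] A)

@[simp]
theorem threeStrands_tmul (t y : TensorAlgebra K A) (p q r : A) :
    threeStrands Φ t y (p ⊗ₜ (q ⊗ₜ r)) = (t * (ι K p * insert Φ y q)) ⊗ₜ r := by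
  simp [threeStrands]

variable {Φ}

theorem IsLinearEAS.apply (hΦ : IsLinearEAS Φ) (z : A ⊗[K] (A ⊗[K] A)) :
    Φ.lTensor A (tensorId Φ (Φ.lTensor A z)) =
      tensorId Φ ((TensorProduct.comm K A A).toLinearMap.lTensor A (tensorId Φ z)) :=
  LinearMap.congr_fun hΦ z

/-- Moving a letter `a` through the word `insert Φ y b`. -/
theorem pass_insert (hΦ : IsLinearEAS Φ) (y t : TensorAlgebra K A) (b a : A) :
    pass Φ (insert Φ y b) (t ⊗ₜ a) = mulMapLeft (insert Φ y) (t ⊗ₜ Φ (a ⊗ₜ b)) := by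
  induction y using word_induction_left generalizing t b a with
  | one =>
    rw [insert_one, pass_ι_tmul]
  | add x y hx hy =>
    simp only [map_add, LinearMap.add_apply, hx, hy, mulMapLeft_add]
  | smul r x hx =>
    simp only [map_smul, LinearMap.smul_apply, hx, mulMapLeft_smul]
  | cons c y ih =>
    -- With z = Φ(b ⊗ c), this is the left side of the semigroup identity on a ⊗ b ⊗ c: the letter a
    -- crosses the first output of z by Φ ⊗ Id, then, by `ih`, the second one by Id ⊗ Φ.
    have hl : ∀ z : A ⊗[K] A, pass Φ (insertStep Φ y z) (t ⊗ₜ a) =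
        threeStrands Φ t y (Φ.lTensor A (tensorId Φ (a ⊗ₜ z))) := by
      intro z
      induction z using TensorProduct.induction_on with
      | zero => simp
      | add z z' h h' =>
        simp only [map_add, LinearMap.add_apply, TensorProduct.tmul_add, h, h']
      | tmul p q =>
        rw [insertStep_tmul, pass_mul, pass_ι_tmul]
        simp only [tensorId, LinearMap.comp_apply, LinearEquiv.coe_coe,
          TensorProduct.assoc_symm_tmul, LinearMap.rTensor_tmul]
        generalize Φ (a ⊗ₜ p) = z
        induction z using TensorProduct.induction_on with
        | zero => simp
        | add z z' h h' =>
          simp only [map_add, TensorProduct.tmul_add, TensorProduct.add_tmul, h, h']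
        | tmul r s =>
          rw [mulMapLeft_tmul, ih]
          simp only [TensorProduct.assoc_tmul, LinearMap.lTensor_tmul]
          generalize Φ (s ⊗ₜ q) = z
          induction z using TensorProduct.induction_on with
          | zero => simp
          | add z z' h h' => simp only [map_add, TensorProduct.tmul_add, h, h']
          | tmul s q => simp [mul_assoc]
    -- With z = Φ(a ⊗ b), this is the right side: the first output of z crosses c, and the flip
    -- brings c next to it.
    have hr : ∀ z : A ⊗[K] A, mulMapLeft (insert Φ (ι K c * y)) (t ⊗ₜ z) =
        threeStrands Φ t y (tensorId Φ ((TensorProduct.comm K A A).toLinearMap.lTensor A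
          (TensorProduct.assoc K A A A (z ⊗ₜ c)))) := by
      intro z
      induction z using TensorProduct.induction_on with
      | zero => simp
      | add z z' h h' =>
        simp only [map_add, TensorProduct.tmul_add, TensorProduct.add_tmul, h, h']
      | tmul d e =>
        rw [mulMapLeft_tmul, insert_ι_mul]
        simp only [tensorId, LinearMap.comp_apply, LinearEquiv.coe_coe, LinearMap.lTensor_tmul,
          TensorProduct.comm_tmul, TensorProduct.assoc_tmul,
          TensorProduct.assoc_symm_tmul, LinearMap.rTensor_tmul]
        generalize Φ (d ⊗ₜ c) = z
        induction z using TensorProduct.induction_on with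
        | zero => simp
        | add z z' h h' =>
          simp only [map_add, TensorProduct.add_tmul, mul_add, h, h']
        | tmul p q => simp
    rw [insert_ι_mul, hl, hr]
    have := hΦ.apply (a ⊗ₜ (b ⊗ₜ c))
    simp only [LinearMap.lTensor_tmul] at this
    rw [this]
    simp [tensorId]

end PhiAssoc
/-! ### Words of a given length, and partial compositions of words -/

namespace PhiAssoc

variable {K : Type u} [Field K] {A : Type v} [AddCommGroup A] [Module K A]

open TensorAlgebra (ι)

/-- The words of length `n` in the tensor algebra. -/
noncomputable def wordsOfLength (K : Type u) [Field K] (A : Type v) [AddCommGroup A] [Module K A]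
    (n : ℕ) : Submodule K (TensorAlgebra K A) :=
  LinearMap.range (ι K : A →ₗ[K] TensorAlgebra K A) ^ n

theorem one_mem_wordsOfLength : (1 : TensorAlgebra K A) ∈ wordsOfLength K A 0 := by
  rw [wordsOfLength, pow_zero]
  exact Submodule.one_le.1 le_rfl

theorem ι_mem_wordsOfLength (a : A) : ι K a ∈ wordsOfLength K A 1 := by
  rw [wordsOfLength, pow_one]
  exact ⟨a, rfl⟩

theorem mul_mem_wordsOfLength {m n k : ℕ} {x y : TensorAlgebra K A}
    (hx : x ∈ wordsOfLength K A m) (hy : y ∈ wordsOfLength K A n) (h : m + n = k) :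
    x * y ∈ wordsOfLength K A k := by
  rw [wordsOfLength, ← h, pow_add]
  exact Submodule.mul_mem_mul hx hy

@[elab_as_elim]
theorem wordsOfLength_zero_induction {P : TensorAlgebra K A → Prop}
    (smul : ∀ (r : K), P (r • 1)) {w : TensorAlgebra K A}
    (hw : w ∈ wordsOfLength K A 0) : P w := by
  rw [wordsOfLength, pow_zero, Submodule.mem_one] at hw
  obtain ⟨r, rfl⟩ := hw
  rw [Algebra.algebraMap_eq_smul_one]
  exact smul r

/-- A property of words of length `n + 1` may be checked on those with a given last letter. -/
@[elab_as_elim]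
theorem wordsOfLength_snoc_induction {n : ℕ} {P : TensorAlgebra K A → Prop}
    (add : ∀ x y, P x → P y → P (x + y))
    (snoc : ∀ v ∈ wordsOfLength K A n, ∀ a, P (v * ι K a)) {w : TensorAlgebra K A}
    (hw : w ∈ wordsOfLength K A (n + 1)) : P w := by
  rw [wordsOfLength, pow_succ] at hw
  refine Submodule.mul_induction_on hw ?_ add
  rintro v hv _ ⟨a, rfl⟩
  exact snoc v hv a

/-- A property of words of length `m + 1 + n` may be checked on words `u b v` with `u`, `v` of
lengths `m` and `n`. -/
@[elab_as_elim]
theorem wordsOfLength_split_induction {m n : ℕ} {P : TensorAlgebra K A → Prop}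
    (add : ∀ x y, P x → P y → P (x + y))
    (split : ∀ u ∈ wordsOfLength K A m, ∀ b, ∀ v ∈ wordsOfLength K A n, P (u * ι K b * v))
    {w : TensorAlgebra K A} (hw : w ∈ wordsOfLength K A (m + 1 + n)) : P w := by
  rw [wordsOfLength, pow_add] at hw
  refine Submodule.mul_induction_on hw ?_ add
  intro x hx v hv
  exact wordsOfLength_snoc_induction (P := fun x => P (x * v))
    (fun x y hx hy => by rw [add_mul]; exact add _ _ hx hy) (fun u hu b => split u hu b v hv) hx

/-- The subspace of `T(A) ⊗ A` of words of length `n`, followed by a letter. -/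
noncomputable def wordsWithLetter (K : Type u) [Field K] (A : Type v) [AddCommGroup A] [Module K A]
    (n : ℕ) : Submodule K (TensorAlgebra K A ⊗[K] A) :=
  Submodule.map₂ (TensorProduct.mk K (TensorAlgebra K A) A) (wordsOfLength K A n) ⊤

theorem tmul_mem_wordsWithLetter {n : ℕ} {t : TensorAlgebra K A} (ht : t ∈ wordsOfLength K A n)
    (a : A) : t ⊗ₜ a ∈ wordsWithLetter K A n :=
  Submodule.apply_mem_map₂ _ ht trivial

theorem wordsWithLetter_le {n : ℕ} {S : Submodule K (TensorAlgebra K A ⊗[K] A)} :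
    wordsWithLetter K A n ≤ S ↔ ∀ t ∈ wordsOfLength K A n, ∀ a, t ⊗ₜ a ∈ S := by
  rw [wordsWithLetter, Submodule.map₂_le]
  simp

theorem mulMapLeft_ι_mem {n : ℕ} {t : TensorAlgebra K A} (ht : t ∈ wordsOfLength K A n)
    (z : A ⊗[K] A) : mulMapLeft (ι K) (t ⊗ₜ z) ∈ wordsWithLetter K A (n + 1) := by
  induction z using TensorProduct.induction_on with
  | zero => simp
  | tmul c d =>
    rw [mulMapLeft_tmul]
    exact tmul_mem_wordsWithLetter (mul_mem_wordsOfLength ht (ι_mem_wordsOfLength c) rfl) d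
  | add x y hx hy =>
    rw [TensorProduct.tmul_add, map_add]
    exact add_mem hx hy

variable (Φ : A ⊗[K] A →ₗ[K] A ⊗[K] A)

/-- Each crossing leaves one letter behind the moving one. Lengths must be tracked because `splice`
locates its position by counting letters from the right. -/
theorem pass_mem {m n : ℕ} {y : TensorAlgebra K A} (hy : y ∈ wordsOfLength K A n)
    {z : TensorAlgebra K A ⊗[K] A} (hz : z ∈ wordsWithLetter K A m) :
    pass Φ y z ∈ wordsWithLetter K A (m + n) := by
  induction n generalizing y with
  | zero =>
    refine wordsOfLength_zero_induction (fun r => ?_) hy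
    simpa using Submodule.smul_mem _ r hz
  | succ n ih =>
    refine wordsOfLength_snoc_induction (fun x y hx hy => ?_) (fun v hv a => ?_) hy
    · rw [map_add, LinearMap.add_apply]
      exact add_mem hx hy
    · rw [pass_mul]
      have : wordsWithLetter K A (m + n) ≤
          (wordsWithLetter K A (m + n + 1)).comap (pass Φ (ι K a)) :=
        wordsWithLetter_le.2 fun t ht b => by
          rw [Submodule.mem_comap, pass_ι_tmul]
          exact mulMapLeft_ι_mem ht _
      exact this (ih hv)

theorem mulMap_ι_mem {n : ℕ} {z : TensorAlgebra K A ⊗[K] A} (hz : z ∈ wordsWithLetter K A n) :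
    mulMap (ι K) z ∈ wordsOfLength K A (n + 1) := by
  have : wordsWithLetter K A n ≤ (wordsOfLength K A (n + 1)).comap (mulMap (ι K)) :=
    wordsWithLetter_le.2 fun t ht b => by
      rw [Submodule.mem_comap, mulMap_tmul]
      exact mul_mem_wordsOfLength ht (ι_mem_wordsOfLength b) rfl
  exact this hz

theorem insert_mem {n : ℕ} {y : TensorAlgebra K A} (hy : y ∈ wordsOfLength K A n) (a : A) :
    insert Φ y a ∈ wordsOfLength K A (n + 1) := by
  rw [insert_apply]
  refine mulMap_ι_mem ?_
  rw [← zero_add n]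
  exact pass_mem Φ hy (tmul_mem_wordsWithLetter one_mem_wordsOfLength a)

/-! ### Splicing a word into a word -/

/-- The partial composition `x ∘_{j+1} y` of words. -/
noncomputable def splice : ℕ → TensorAlgebra K A →ₗ[K] TensorAlgebra K A →ₗ[K] TensorAlgebra K A
  | 0 => LinearMap.mul K (TensorAlgebra K A)
  | 1 => ((pass Φ).flip ∘ₗ splitLast K A).compr₂ (mulMap (ι K))
  | j + 2 => TensorProduct.lift
      (LinearMap.mk₂ K (fun x a => LinearMap.mulRight K (ι K a) ∘ₗ splice (j + 1) x)
          (fun x y a => by ext; simp [add_mul]) (fun r x a => by ext; simp)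
          (fun x a b => by ext; simp [mul_add]) (fun r x a => by ext; simp)) ∘ₗ splitLast K A

@[simp]
theorem splice_zero (x y : TensorAlgebra K A) : splice Φ 0 x y = x * y := by
  simp [splice]

theorem splice_one_mulMap (z : TensorAlgebra K A ⊗[K] A) (y : TensorAlgebra K A) :
    splice Φ 1 (mulMap (ι K) z) y = mulMap (insert Φ y) z := by
  simp [splice, splitLast_mulMap, mulMap_pass]

theorem splice_one_mul_ι (x y : TensorAlgebra K A) (a : A) :
    splice Φ 1 (x * ι K a) y = x * insert Φ y a := by
  rw [← mulMap_tmul, splice_one_mulMap, mulMap_tmul]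

theorem splice_mul_ι (j : ℕ) (x y : TensorAlgebra K A) (a : A) :
    splice Φ (j + 2) (x * ι K a) y = splice Φ (j + 1) x y * ι K a := by
  simp [splice, splitLast_mul_ι]

/-- Letters on the right of the splicing position are not affected. -/
theorem splice_mul_right {j s : ℕ} {v : TensorAlgebra K A} (hv : v ∈ wordsOfLength K A s)
    (x y : TensorAlgebra K A) : splice Φ (j + 1 + s) (x * v) y = splice Φ (j + 1) x y * v := by
  induction s generalizing v with
  | zero =>
    refine wordsOfLength_zero_induction (fun r => ?_) hv
    simp
  | succ s ih =>
    refine wordsOfLength_snoc_induction (fun v v' h h' => ?_) (fun v hv a => ?_) hv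
    · simp only [mul_add, map_add, LinearMap.add_apply, h, h']
    · have : j + 1 + (s + 1) = j + s + 2 := by omega
      rw [← mul_assoc, this, splice_mul_ι, ← mul_assoc, ← ih hv]
      congr 4
      omega

/-- The working description of `splice` at a positive index, and the form of the second composition
formula: the letter with s letters to its right absorbs y through Ψ. -/
theorem splice_mul_ι_mul {s : ℕ} {v : TensorAlgebra K A} (hv : v ∈ wordsOfLength K A s)
    (x y : TensorAlgebra K A) (a : A) :
    splice Φ (s + 1) (x * ι K a * v) y = x * insert Φ y a * v := by
  rw [← splice_one_mul_ι, ← splice_mul_right Φ (j := 0) hv]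
  congr 3
  omega

/-- Letters on the left of the splicing position are not affected. -/
theorem splice_mul_left {j n : ℕ} (hj : j ≤ n) {v : TensorAlgebra K A}
    (hv : v ∈ wordsOfLength K A n) (u y : TensorAlgebra K A) :
    splice Φ j (u * v) y = u * splice Φ j v y := by
  obtain _ | j := j
  · simp [mul_assoc]
  -- Isolates the letter to be replaced, which has j letters on its right and m on its left within
  -- v.
  · obtain ⟨m, rfl⟩ : ∃ m, n = m + 1 + j := ⟨n - 1 - j, by omega⟩
    refine wordsOfLength_split_induction (fun v v' h h' => ?_) (fun x hx b v hv => ?_) hv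
    · simp only [mul_add, map_add, LinearMap.add_apply, h, h']
    · rw [← mul_assoc, ← mul_assoc, splice_mul_ι_mul Φ hv, splice_mul_ι_mul Φ hv]
      simp only [mul_assoc]

variable {Φ}

/-- Sequential composition for words in the second input of a letter. -/
theorem insert_splice (hΦ : IsLinearEAS Φ) {j n : ℕ} (hj : j ≤ n) {w : TensorAlgebra K A}
    (hw : w ∈ wordsOfLength K A n) (a : A) (y : TensorAlgebra K A) :
    insert Φ (splice Φ j w y) a = splice Φ (j + 1) (insert Φ w a) y := by
  obtain _ | j := j
  -- At index 0 the word y follows w, so the moving letter crosses w and what remains of it then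
  -- crosses y. The semigroup identity plays no role here.
  · rw [splice_zero, insert_apply, pass_mul, mulMap_pass, insert_apply, splice_one_mulMap]
  · obtain ⟨m, rfl⟩ : ∃ m, n = m + 1 + j := ⟨n - 1 - j, by omega⟩
    refine wordsOfLength_split_induction (fun v v' h h' => ?_) (fun u hu b v hv => ?_) hw
    · simp only [map_add, LinearMap.add_apply, h, h']
    · rw [splice_mul_ι_mul Φ hv, insert_apply Φ (u * insert Φ y b * v),
        insert_apply Φ (u * ι K b * v), pass_mul, pass_mul, pass_mul, pass_mul]
      generalize pass Φ u (1 ⊗ₜ a) = z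
      induction z using TensorProduct.induction_on with
      | zero => simp
      | add z z' h h' => simp only [map_add, LinearMap.add_apply, h, h']
      | tmul t c =>
        -- After u, the moving letter c meets Ψ(b y) on one side and b on the other; `pass_insert`
        -- makes both depend only on Φ(c ⊗ b).
        rw [pass_insert hΦ, pass_ι_tmul]
        generalize Φ (c ⊗ₜ b) = z
        induction z using TensorProduct.induction_on with
        | zero => simp
        | add z z' h h' =>
          simp only [TensorProduct.tmul_add, map_add, LinearMap.add_apply, h, h']
        | tmul p q =>
          rw [mulMapLeft_tmul, mulMapLeft_tmul, mulMap_pass, mulMap_pass, mulMap_tmul, mulMap_tmul,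
            splice_mul_ι_mul Φ (insert_mem Φ hv q)]

/-! ### Evaluation of trees -/

variable (Φ)

/-- The normal form of a decorated tree. -/
noncomputable def evalTree : BinaryTree A → TensorAlgebra K A
  | .nil => 1
  | .node a l r => insert Φ (evalTree r) a * evalTree l

theorem evalTree_mem (t : BinaryTree A) : evalTree Φ t ∈ wordsOfLength K A t.numNodes := by
  induction t with
  | nil => exact one_mem_wordsOfLength
  | node a l r hl hr =>
    refine mul_mem_wordsOfLength (insert_mem Φ hr a) hl ?_
    rw [BinaryTree.numNodes]
    omega

variable {Φ}

/-- The word of the left subtree stands last, so leaves counted from the left match positions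
counted from the right. A graft in the left subtree happens to the right of the root's factor Ψ; a
graft in the right subtree happens inside it, and there `insert_splice` is needed. -/
theorem evalTree_graft (hΦ : IsLinearEAS Φ) (t s : BinaryTree A) (i : ℕ) (hi : 1 ≤ i)
    (hit : i ≤ t.numLeaves) :
    evalTree Φ (DecTree.graft t i s) = splice Φ (i - 1) (evalTree Φ t) (evalTree Φ s) := by
  induction t generalizing i with
  | nil =>
    simp only [BinaryTree.numLeaves] at hit
    obtain rfl : i = 1 := by omega
    simp [DecTree.graft, evalTree]
  | node a l r ihl ihr =>
    simp only [BinaryTree.numLeaves] at hit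
    have hl := evalTree_mem Φ l
    have hr := evalTree_mem Φ r
    have nl := l.numLeaves_eq_numNodes_succ
    have nr := r.numLeaves_eq_numNodes_succ
    by_cases h : i ≤ l.numLeaves
    · rw [DecTree.graft, if_pos h, evalTree, ihl i hi h, evalTree,
        splice_mul_left Φ (by omega) hl]
    · rw [DecTree.graft, if_neg h, evalTree, ihr _ (by omega) (by omega),
        insert_splice hΦ (by omega) hr, evalTree, ← splice_mul_right Φ hl]
      congr 4
      omega

end PhiAssoc
/-! ### Tensor powers inside the tensor algebra -/

namespace PhiAssoc

variable {K : Type u} [Field K] {A : Type v} [AddCommGroup A] [Module K A]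

open TensorAlgebra (ι)
open TensorPower (toTensorAlgebra)

/-- Composed with the isomorphism from the tensor algebra to the direct sum of tensor powers, this
is the inclusion of one summand. -/
theorem toTensorAlgebra_injective (n : ℕ) :
    Function.Injective (toTensorAlgebra : ⨂[K]^n A →ₗ[K] TensorAlgebra K A) := by
  have h : ∀ x : ⨂[K]^n A, TensorAlgebra.toDirectSum (toTensorAlgebra x) =
      DirectSum.of (fun n => ⨂[K]^n A) n x := by
    intro x
    induction x using PiTensorProduct.induction_on with
    | smul_tprod r x =>
      rw [map_smul, map_smul, TensorPower.toTensorAlgebra_tprod,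
        TensorAlgebra.toDirectSum_tensorPower_tprod, ← DirectSum.lof_eq_of K, ← map_smul,
        DirectSum.lof_eq_of]
    | add x y hx hy => simp only [map_add, hx, hy]
  intro x y hxy
  apply DirectSum.of_injective (β := fun n => ⨂[K]^n A) n
  rw [← h, ← h, hxy]

theorem toTensorAlgebra_conc {m n : ℕ} (x : ⨂[K]^m A) (y : ⨂[K]^n A) :
    toTensorAlgebra (conc x y) = toTensorAlgebra x * toTensorAlgebra y :=
  TensorPower.toTensorAlgebra_gMul x y

theorem toTensorAlgebra_cast {m n : ℕ} (h : m = n) (x : ⨂[K]^m A) :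
    toTensorAlgebra (TensorPower.cast K A h x) = toTensorAlgebra x := by
  subst h
  simp

@[simp]
theorem toTensorAlgebra_letter (a : A) : toTensorAlgebra (letter K a) = ι K a := by
  simp [letter]

theorem toTensorAlgebra_squareEquiv (z : A ⊗[K] A) :
    toTensorAlgebra (squareEquiv K A z) = mulMap (ι K) ((ι K).rTensor A z) := by
  induction z using TensorProduct.induction_on with
  | zero => simp
  | add x y hx hy => simp only [map_add, hx, hy]
  | tmul a b =>
    have : squareEquiv K A (a ⊗ₜ b) = conc (letter K a) (letter K b) := by
      simp [squareEquiv, conc, letter]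
    rw [this]
    refine (toTensorAlgebra_conc _ _).trans ?_
    simp

theorem toTensorAlgebra_mem {n : ℕ} (x : ⨂[K]^n A) :
    toTensorAlgebra x ∈ wordsOfLength K A n := by
  induction x using PiTensorProduct.induction_on with
  | smul_tprod r x =>
    rw [map_smul, TensorPower.toTensorAlgebra_tprod, TensorAlgebra.tprod_apply]
    refine Submodule.smul_mem _ r ?_
    induction n with
    | zero => simpa using one_mem_wordsOfLength
    | succ n ih =>
      rw [List.ofFn_succ, List.prod_cons]
      exact mul_mem_wordsOfLength (ι_mem_wordsOfLength _) (ih fun i => x i.succ) (add_comm _ _)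
  | add x y hx hy =>
    rw [map_add]
    exact add_mem hx hy

theorem exists_toTensorAlgebra_eq {n : ℕ} {w : TensorAlgebra K A} (hw : w ∈ wordsOfLength K A n) :
    ∃ x : ⨂[K]^n A, toTensorAlgebra x = w := by
  induction n generalizing w with
  | zero =>
    refine wordsOfLength_zero_induction (fun r => ?_) hw
    exact ⟨r • PiTensorProduct.tprod K Fin.elim0, by simp⟩
  | succ n ih =>
    refine wordsOfLength_snoc_induction ?_ (fun v hv a => ?_) hw
    · rintro _ _ ⟨x, rfl⟩ ⟨y, rfl⟩
      exact ⟨x + y, map_add _ _ _⟩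
    · obtain ⟨x, rfl⟩ := ih hv
      exact ⟨conc x (letter K a), by rw [toTensorAlgebra_conc, toTensorAlgebra_letter]⟩

/-! ### The composite Ψ_l on tensor powers agrees with `insert` -/

variable (Φ : A ⊗[K] A →ₗ[K] A ⊗[K] A)

theorem powMap_conc {m n : ℕ} (f : ⨂[K]^m A →ₗ[K] ⨂[K]^m A) (g : ⨂[K]^n A →ₗ[K] ⨂[K]^n A)
    (x : ⨂[K]^m A) (y : ⨂[K]^n A) : powMap f g (conc x y) = conc (f x) (g y) := by
  simp [powMap, conc]

theorem phiAt_conc {n : ℕ} (p q : ℕ) (h : p + 2 + q = n) (x : ⨂[K]^p A) (z : A ⊗[K] A)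
    (y : ⨂[K]^q A) :
    phiAt Φ p q h (TensorPower.cast K A h (conc (conc x (squareEquiv K A z)) y)) =
      TensorPower.cast K A h (conc (conc x (squareEquiv K A (Φ z))) y) := by
  simp [phiAt, powMap_conc]

/-- `phiAt` on a word whose letters of ranks `p + 1` and `p + 2` are `d` and `c`. -/
theorem toTensorAlgebra_phiAt {n p q : ℕ} (h : p + 2 + q = n) {z : TensorAlgebra K A ⊗[K] A}
    (hz : z ∈ wordsWithLetter K A p) (c : A) {v : TensorAlgebra K A}
    (hv : v ∈ wordsOfLength K A q) {x : ⨂[K]^n A}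
    (hx : toTensorAlgebra x = mulMap (ι K) z * (ι K c * v)) :
    toTensorAlgebra (phiAt Φ p q h x) = mulMap (ι K) (pass Φ (ι K c) z) * v := by
  obtain ⟨y, rfl⟩ := exists_toTensorAlgebra_eq hv
  -- Having a preimage x with the right image is a linear condition on z, so it can be checked on t
  -- ⊗ d. Injectivity then identifies that preimage with the given x.
  let S : Submodule K (TensorAlgebra K A ⊗[K] A) :=
    { carrier := {z | ∃ x : ⨂[K]^n A,
        toTensorAlgebra x = mulMap (ι K) z * (ι K c * toTensorAlgebra y) ∧
        toTensorAlgebra (phiAt Φ p q h x) = mulMap (ι K) (pass Φ (ι K c) z) * toTensorAlgebra y}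
      zero_mem' := ⟨0, by simp⟩
      add_mem' := by
        rintro z z' ⟨x, h, k⟩ ⟨x', h', k'⟩
        exact ⟨x + x', by simp only [map_add, h, h', add_mul], by simp only [map_add, k, k', add_mul]⟩
      smul_mem' := by
        rintro r z ⟨x, h, k⟩
        exact ⟨r • x, by simp only [map_smul, h, smul_mul_assoc],
          by simp only [map_smul, k, smul_mul_assoc]⟩ }
  have hS : wordsWithLetter K A p ≤ S := wordsWithLetter_le.2 fun t ht d => by
    obtain ⟨u, rfl⟩ := exists_toTensorAlgebra_eq ht
    refine ⟨TensorPower.cast K A h (conc (conc u (squareEquiv K A (d ⊗ₜ c))) y), ?_, ?_⟩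
    · simp [toTensorAlgebra_cast, toTensorAlgebra_conc, toTensorAlgebra_squareEquiv, mul_assoc]
    · rw [phiAt_conc, toTensorAlgebra_cast, toTensorAlgebra_conc, toTensorAlgebra_conc,
        toTensorAlgebra_squareEquiv, pass_ι_tmul]
      congr 1
      generalize Φ (d ⊗ₜ c) = z
      induction z using TensorProduct.induction_on with
      | zero => simp
      | add z z' h h' => simp only [map_add, mul_add, TensorProduct.tmul_add, h, h']
      | tmul a b => simp [mul_assoc]
  obtain ⟨x', h1, h2⟩ := hS hz
  rw [toTensorAlgebra_injective n (hx.trans h1.symm), h2]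

/-- Loop invariant of the composite: after t factors the letter a has crossed the first t letters,
u, and v is untouched. An existential form allows induction on words in the tensor algebra. -/
theorem exists_toTensorAlgebra_sweepAux (l t : ℕ) (ht : t ≤ l) (a : A) {u : TensorAlgebra K A}
    (hu : u ∈ wordsOfLength K A t) {v : TensorAlgebra K A} (hv : v ∈ wordsOfLength K A (l - t)) :
    ∃ x : ⨂[K]^(1 + l) A, toTensorAlgebra x = ι K a * u * v ∧
      toTensorAlgebra (sweepAux Φ l t ht x) = insert Φ u a * v := by
  induction t generalizing u v with
  | zero =>
    refine wordsOfLength_zero_induction (fun r => ?_) hu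
    obtain ⟨x, hx⟩ := exists_toTensorAlgebra_eq
      (mul_mem_wordsOfLength (ι_mem_wordsOfLength a) hv (by rw [Nat.sub_zero]))
    exact ⟨r • x, by simp [hx], by simp [sweepAux, hx, insert_one]⟩
  | succ t ih =>
    refine wordsOfLength_snoc_induction ?_ (fun u hu c => ?_) hu
    · rintro w w' ⟨x, h, k⟩ ⟨x', h', k'⟩
      exact ⟨x + x', by simp only [map_add, h, h', mul_add, add_mul],
        by simp only [map_add, k, k', add_mul, LinearMap.add_apply]⟩
    · obtain ⟨x, h, k⟩ := ih (by omega) hu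
        (mul_mem_wordsOfLength (ι_mem_wordsOfLength c) hv (by omega))
      refine ⟨x, by simp only [h, mul_assoc], ?_⟩
      rw [insert_apply] at k
      rw [sweepAux, LinearMap.comp_apply, insert_apply, pass_mul]
      refine toTensorAlgebra_phiAt Φ _ ?_ c ?_ k
      · rw [← zero_add t]
        exact pass_mem Φ hu (tmul_mem_wordsWithLetter one_mem_wordsOfLength a)
      · convert hv using 2
        omega

theorem toTensorAlgebra_sweep (l : ℕ) (a : A) (b : ⨂[K]^l A) :
    toTensorAlgebra (sweep Φ l (conc (letter K a) b)) = insert Φ (toTensorAlgebra b) a := by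
  obtain ⟨x, h, k⟩ := exists_toTensorAlgebra_sweepAux Φ l l le_rfl a (toTensorAlgebra_mem b)
    (v := 1) (by rw [Nat.sub_self]; exact one_mem_wordsOfLength)
  have : conc (letter K a) b = x := toTensorAlgebra_injective _ <| by
    rw [h, toTensorAlgebra_conc, toTensorAlgebra_letter, mul_one]
  rw [this, sweep, k, mul_one]

end PhiAssoc
/-! ### Ideals of an operad as kernels -/

namespace NSOperad

variable {K : Type u} [Field K] {V : Type v} [AddCommGroup V] [Module K V]

/-- The kernel of linear maps compatible with the partial compositions. -/
def kerIdeal (P : NSOperad.{u, w} K) (f : ∀ n, P.obj n →ₗ[K] V) (C : ℕ → V →ₗ[K] V →ₗ[K] V)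
    (hf : ∀ {m n k : ℕ} (i : ℕ) (hi : 1 ≤ i ∧ i ≤ m) (h : k + 1 = m + n) (x : P.obj m)
      (y : P.obj n), f k (P.circ i hi h x y) = C i (f m x) (f n y)) : P.OperadicIdeal where
  carrier n := LinearMap.ker (f n)
  circ_mem_left i hi h x y hx := by
    rw [LinearMap.mem_ker] at hx ⊢
    rw [hf, hx, map_zero, LinearMap.zero_apply]
  circ_mem_right i hi h x y hy := by
    rw [LinearMap.mem_ker] at hy ⊢
    rw [hf, hy, map_zero]

theorem idealSpan_le (P : NSOperad.{u, w} K) (R : ∀ n, Set (P.obj n)) (I : P.OperadicIdeal)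
    (hR : ∀ n, R n ⊆ I.carrier n) (n : ℕ) : (P.idealSpan R).carrier n ≤ I.carrier n :=
  iInf₂_le I hR

end NSOperad

/-! ### Evaluation on the operad of `Φ`-associative algebras -/

namespace PhiAssoc

variable {K : Type u} [Field K] {A : Type v} [AddCommGroup A] [Module K A]

open TensorAlgebra (ι)
open TensorPower (toTensorAlgebra)
open DecTree

/-- Normal forms of linear combinations of trees. -/
noncomputable def treeEval (Φ : A ⊗[K] A →ₗ[K] A ⊗[K] A) (n : ℕ) :
    (Trees A n →₀ K) →ₗ[K] TensorAlgebra K A :=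
  Finsupp.linearCombination K fun t : Trees A n => evalTree Φ t.1

theorem treeEval_single (Φ : A ⊗[K] A →ₗ[K] A ⊗[K] A) {n : ℕ} (t : Trees A n) (c : K) :
    treeEval Φ n (Finsupp.single t c) = c • evalTree Φ t.1 :=
  Finsupp.linearCombination_single K c t

/-- Normal forms of elements of the operad of trees. -/
noncomputable def treeOperadEval (Φ : A ⊗[K] A →ₗ[K] A ⊗[K] A) (n : ℕ) :
    (treeOperad K A).obj n →ₗ[K] TensorAlgebra K A :=
  treeEval Φ n

theorem treeOperadEval_corolla (Φ : A ⊗[K] A →ₗ[K] A ⊗[K] A) (a : A) :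
    treeOperadEval Φ 2 (corolla K a) = ι K a := by
  refine (treeEval_single Φ (Trees.corolla a) 1).trans ?_
  simp [Trees.corolla, evalTree, insert_one]

variable {Φ : A ⊗[K] A →ₗ[K] A ⊗[K] A}

theorem treeEval_linGraft (hΦ : IsLinearEAS Φ) {m n k : ℕ} (i : ℕ) (hi : 1 ≤ i ∧ i ≤ m) (h : k + 1 = m + n)
    (x : Trees A m →₀ K) (y : Trees A n →₀ K) :
    treeEval Φ k (linGraft K i hi h x y) =
      splice Φ (i - 1) (treeEval Φ m x) (treeEval Φ n y) := by
  suffices H : (linGraft K i hi h).compr₂ (treeEval Φ k) =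
      (splice Φ (i - 1)).compl₁₂ (treeEval Φ m) (treeEval Φ n) from
    LinearMap.congr_fun₂ H x y
  refine Finsupp.lhom_ext fun t c => Finsupp.lhom_ext fun s d => ?_
  rw [LinearMap.compr₂_apply, LinearMap.compl₁₂_apply, linGraft_single]
  rw [treeEval_single, treeEval_single, treeEval_single, Trees.graft,
    evalTree_graft hΦ _ _ _ hi.1 (by rw [t.2]; exact hi.2)]
  simp only [map_smul, LinearMap.smul_apply]
  rw [mul_comm, mul_smul]

theorem treeOperadEval_circ (hΦ : IsLinearEAS Φ) {m n k : ℕ} (i : ℕ) (hi : 1 ≤ i ∧ i ≤ m) (h : k + 1 = m + n)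
    (x : (treeOperad K A).obj m) (y : (treeOperad K A).obj n) :
    treeOperadEval Φ k ((treeOperad K A).circ i hi h x y) =
      splice Φ (i - 1) (treeOperadEval Φ m x) (treeOperadEval Φ n y) :=
  treeEval_linGraft hΦ i hi h x y

/-- The kernel of evaluation is an operadic ideal, so only the generating relations need checking;
they hold because `insert Φ 1` is linear. -/
theorem linearityIdeal_le_ker (hΦ : IsLinearEAS Φ) (n : ℕ) :
    (linearityIdeal K A).carrier n ≤ LinearMap.ker (treeOperadEval Φ n) := by
  refine NSOperad.idealSpan_le _ _ ((treeOperad K A).kerIdeal (treeOperadEval Φ)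
    (fun i => splice Φ (i - 1)) (treeOperadEval_circ hΦ)) ?_ n
  rintro n x (⟨a, b⟩ | ⟨c, a⟩)
  · change treeOperadEval Φ 2 _ = 0
    simp [treeOperadEval_corolla]
  · change treeOperadEval Φ 2 _ = 0
    simp [treeOperadEval_corolla]

/-- Normal forms of elements of the free operad. -/
noncomputable def freeEval (hΦ : IsLinearEAS Φ) (n : ℕ) : (freeOperad K A).obj n →ₗ[K] TensorAlgebra K A :=
  ((linearityIdeal K A).carrier n).liftQ (treeOperadEval Φ n) (linearityIdeal_le_ker hΦ n)

theorem freeEval_freeGen (hΦ : IsLinearEAS Φ) (a : A) : freeEval hΦ 2 (freeGen K A a) = ι K a :=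
  treeOperadEval_corolla Φ a

theorem freeEval_circ (hΦ : IsLinearEAS Φ) {m n k : ℕ} (i : ℕ) (hi : 1 ≤ i ∧ i ≤ m) (h : k + 1 = m + n)
    (x : (freeOperad K A).obj m) (y : (freeOperad K A).obj n) :
    freeEval hΦ k ((freeOperad K A).circ i hi h x y) =
      splice Φ (i - 1) (freeEval hΦ m x) (freeEval hΦ n y) := by
  obtain ⟨x, rfl⟩ := Submodule.Quotient.mk_surjective _ x
  obtain ⟨y, rfl⟩ := Submodule.Quotient.mk_surjective _ y
  exact treeOperadEval_circ hΦ i hi h x y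

theorem assocIdeal_le_ker (hΦ : IsLinearEAS Φ) (n : ℕ) :
    (assocIdeal Φ).carrier n ≤ LinearMap.ker (freeEval hΦ n) := by
  refine NSOperad.idealSpan_le _ _ ((freeOperad K A).kerIdeal (freeEval hΦ)
    (fun i => splice Φ (i - 1)) (freeEval_circ hΦ)) ?_ n
  rintro n x ⟨a, b⟩
  change freeEval hΦ 3 _ = 0
  have h1 : ∀ z : A ⊗[K] A, freeEval hΦ 3 (freeCircOne K A z) =
      mulMap (ι K) ((ι K).rTensor A z) := by
    intro z
    induction z using TensorProduct.induction_on with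
    | zero => simp
    | add z z' h h' => simp only [map_add, h, h']
    | tmul c d =>
      simp only [freeCircOne, TensorProduct.lift.tmul, LinearMap.compl₁₂_apply]
      rw [freeEval_circ, freeEval_freeGen, freeEval_freeGen]
      simp
  rw [map_sub, freeEval_circ, freeEval_freeGen, freeEval_freeGen, h1, ← one_mul (ι K a),
    splice_one_mul_ι, insert_apply, pass_ι_tmul]
  generalize Φ (a ⊗ₜ b) = z
  induction z using TensorProduct.induction_on with
  | zero => simp
  | add z z' h h' =>
    simp only [map_add, TensorProduct.tmul_add, mul_add, add_sub_add_comm, h, h', add_zero]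
  | tmul c d => simp

/-- Normal forms of elements of `As_Φ`. -/
noncomputable def asEval (hΦ : IsLinearEAS Φ) (n : ℕ) : (As Φ).obj n →ₗ[K] TensorAlgebra K A :=
  ((assocIdeal Φ).carrier n).liftQ (freeEval hΦ n) (assocIdeal_le_ker hΦ n)

theorem asEval_one (hΦ : IsLinearEAS Φ) : asEval hΦ 1 (As Φ).one = 1 :=
  (treeEval_single Φ Trees.nil 1).trans (one_smul K _)

theorem asEval_gen (hΦ : IsLinearEAS Φ) (a : A) : asEval hΦ 2 (As.gen Φ a) = ι K a :=
  treeOperadEval_corolla Φ a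

theorem asEval_circ (hΦ : IsLinearEAS Φ) {m n k : ℕ} (i : ℕ) (hi : 1 ≤ i ∧ i ≤ m) (h : k + 1 = m + n)
    (x : (As Φ).obj m) (y : (As Φ).obj n) :
    asEval hΦ k ((As Φ).circ i hi h x y) = splice Φ (i - 1) (asEval hΦ m x) (asEval hΦ n y) := by
  obtain ⟨x, rfl⟩ := Submodule.Quotient.mk_surjective _ x
  obtain ⟨y, rfl⟩ := Submodule.Quotient.mk_surjective _ y
  exact freeEval_circ hΦ i hi h x y

end PhiAssoc
/-! ### Combs span the operad of `Φ`-associative algebras -/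

namespace PhiAssoc

variable {K : Type u} [Field K] {A : Type v} [AddCommGroup A] [Module K A]

open TensorAlgebra (ι)
open TensorPower (toTensorAlgebra)
open DecTree

/-- Splitting off the first letter of a tensor. -/
noncomputable def consEquiv (K : Type u) [Field K] (A : Type v) [AddCommGroup A] [Module K A]
    (n : ℕ) : A ⊗[K] (⨂[K]^n A) ≃ₗ[K] ⨂[K]^(n + 1) A :=
  (TensorProduct.congr (PiTensorProduct.subsingletonEquiv (R := K) (s := fun _ : Fin 1 => A) 0).symm
    (LinearEquiv.refl K (⨂[K]^n A))).trans
    (TensorPower.mulEquiv.trans (TensorPower.cast K A (add_comm 1 n)))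

theorem toTensorAlgebra_consEquiv (n : ℕ) (a : A) (x : ⨂[K]^n A) :
    toTensorAlgebra (consEquiv K A n (a ⊗ₜ x)) = ι K a * toTensorAlgebra x := by
  have : consEquiv K A n (a ⊗ₜ x) =
      TensorPower.cast K A (add_comm 1 n) (conc (letter K a) x) := by
    simp [consEquiv, conc, letter]
  rw [this, toTensorAlgebra_cast, toTensorAlgebra_conc, toTensorAlgebra_letter]

variable (Φ : A ⊗[K] A →ₗ[K] A ⊗[K] A)

/-- The left comb with vertices decorated by a word. -/
noncomputable def comb : ∀ n : ℕ, ⨂[K]^n A →ₗ[K] (As Φ).obj (n + 1)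
  | 0 => LinearMap.toSpanSingleton K _ (As Φ).one ∘ₗ TensorPower.algebraMap₀.symm.toLinearMap
  | n + 1 => TensorProduct.lift
      (((As Φ).circ (m := 2) (n := n + 1) (k := n + 2) 1 (by omega) (by omega)).compl₁₂
        (As.gen Φ) (comb n)) ∘ₗ (consEquiv K A n).symm.toLinearMap

theorem comb_algebraMap (r : K) : comb Φ 0 (TensorPower.algebraMap₀ r) = r • (As Φ).one := by
  simp [comb]

theorem comb_consEquiv (n : ℕ) (a : A) (x : ⨂[K]^n A) :
    comb Φ (n + 1) (consEquiv K A n (a ⊗ₜ x)) =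
      (As Φ).circ (m := 2) (n := n + 1) (k := n + 2) 1 (by omega) (by omega)
        (As.gen Φ a) (comb Φ n x) := by
  simp [comb]

theorem circ_gen_mem_range_comb {n k : ℕ} (hk : k + 2 = 2 + (n + 1)) (a : A)
    {x : (As Φ).obj (n + 1)} (hx : x ∈ LinearMap.range (comb Φ n)) :
    (As Φ).circ (k := k + 1) 1 (by omega) hk (As.gen Φ a) x ∈ LinearMap.range (comb Φ k) := by
  obtain ⟨x, rfl⟩ := hx
  obtain rfl : k = n + 1 := by omega
  exact ⟨_, comb_consEquiv Φ n a x⟩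

/-- Elements in the range of `comb` are obtained from the unit by composing generators. -/
theorem range_comb_induction {P : ∀ n, (As Φ).obj (n + 1) → Prop}
    (one : P 0 (As Φ).one) (smul : ∀ n (r : K) x, P n x → P n (r • x))
    (add : ∀ n x y, P n x → P n y → P n (x + y))
    (circ : ∀ n a x, x ∈ LinearMap.range (comb Φ n) → P n x →
      P (n + 1) ((As Φ).circ (m := 2) (n := n + 1) (k := n + 2) 1 (by omega) (by omega)
        (As.gen Φ a) x))
    (n : ℕ) (x : (As Φ).obj (n + 1)) (hx : x ∈ LinearMap.range (comb Φ n)) : P n x := by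
  obtain ⟨x, rfl⟩ := hx
  induction n with
  | zero =>
    obtain ⟨r, rfl⟩ := TensorPower.algebraMap₀.surjective x
    rw [comb_algebraMap]
    exact smul 0 r _ one
  | succ n ih =>
    obtain ⟨z, rfl⟩ := (consEquiv K A n).surjective x
    induction z using TensorProduct.induction_on with
    | zero =>
      have := smul (n + 1) 0 _ (circ n 0 0 (zero_mem _) (by simpa using ih 0))
      simpa using this
    | add z z' h h' =>
      rw [map_add, map_add]
      exact add _ _ _ h h'
    | tmul a x =>
      rw [comb_consEquiv]
      exact circ n a _ ⟨x, rfl⟩ (ih x)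

theorem gen_circ_two (a b : A) :
    (As Φ).circ (m := 2) (n := 2) (k := 3) 2 (by decide) rfl (As.gen Φ a) (As.gen Φ b) =
      As.mk Φ 3 (freeCircOne K A (Φ (a ⊗ₜ b))) := by
  rw [← sub_eq_zero]
  have h := NSOperad.quotMk_eq_zero _ (assocIdeal Φ)
    (NSOperad.subset_idealSpan _ (fun n => {x | AssocRel Φ n x}) (AssocRel.rel (Φ := Φ) a b))
  rw [map_sub] at h
  exact h

theorem mk_freeCircOne_tmul (a b : A) :
    As.mk Φ 3 (freeCircOne K A (a ⊗ₜ b)) =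
      (As Φ).circ (m := 2) (n := 2) (k := 3) 1 (by decide) rfl (As.gen Φ a) (As.gen Φ b) := rfl

theorem circ_one_mem_range_comb {m n k : ℕ} (h : k + 2 = (m + 1) + (n + 1))
    {x : (As Φ).obj (m + 1)} (hx : x ∈ LinearMap.range (comb Φ m))
    {y : (As Φ).obj (n + 1)} (hy : y ∈ LinearMap.range (comb Φ n)) :
    (As Φ).circ (k := k + 1) 1 (by omega) h x y ∈ LinearMap.range (comb Φ k) := by
  revert k
  refine range_comb_induction Φ (P := fun m x => ∀ {k : ℕ} (h : k + 2 = (m + 1) + (n + 1)),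
    (As Φ).circ (k := k + 1) 1 (by omega) h x y ∈ LinearMap.range (comb Φ k))
    ?_ ?_ ?_ ?_ m x hx
  · intro k h
    obtain rfl : k = n := by omega
    rw [(As Φ).one_circ]
    exact hy
  · intro m r x hx k h
    rw [map_smul, LinearMap.smul_apply]
    exact Submodule.smul_mem _ r (hx h)
  · intro m x x' hx hx' k h
    rw [map_add, LinearMap.add_apply]
    exact add_mem (hx h) (hx' h)
  · intro m a x _ ih k h
    obtain ⟨k, rfl⟩ : ∃ k', k = k' + 1 := ⟨k - 1, by omega⟩
    have := (As Φ).seq (l := 2) (m := m + 1) (n := n + 1) (p := m + 2) (q := k + 1) (r := k + 2)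
      1 1 (by omega) (by omega) (by omega) (by omega) (by omega) (by omega) (by omega)
      (As.gen Φ a) x y
    refine Eq.mp (congrArg (· ∈ _) this.symm) ?_
    exact circ_gen_mem_range_comb Φ _ a (ih (by omega))

theorem gen_circ_two_mem_range_comb {n k : ℕ} (h : k + 2 = 2 + (n + 1)) (a : A)
    {y : (As Φ).obj (n + 1)} (hy : y ∈ LinearMap.range (comb Φ n)) :
    (As Φ).circ (k := k + 1) 2 (by omega) h (As.gen Φ a) y ∈ LinearMap.range (comb Φ k) := by
  revert a k
  refine range_comb_induction Φ (P := fun n y => ∀ {k : ℕ} (h : k + 2 = 2 + (n + 1)) (a : A),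
    (As Φ).circ (k := k + 1) 2 (by omega) h (As.gen Φ a) y ∈ LinearMap.range (comb Φ k))
    ?_ ?_ ?_ ?_ n y hy
  · intro k h a
    obtain rfl : k = 1 := by omega
    rw [(As Φ).circ_one, ← (As Φ).circ_one 1 (by omega) (by omega) (As.gen Φ a)]
    refine circ_gen_mem_range_comb Φ (n := 0) _ a ⟨TensorPower.algebraMap₀ 1, ?_⟩
    rw [comb_algebraMap, one_smul]
  · intro n r y hy k h a
    rw [map_smul]
    exact Submodule.smul_mem _ r (hy h a)
  · intro n y y' hy hy' k h a
    rw [map_add]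
    exact add_mem (hy h a) (hy' h a)
  · intro n b y _ ih k h a
    obtain rfl : k = n + 2 := by omega
    rw [← (As Φ).seq (l := 2) (m := 2) (n := n + 1) (p := 3) (q := n + 2) (r := n + 3)
      2 1 (by omega) (by omega) rfl (by omega) (by omega) (by omega) (by omega)
      (As.gen Φ a) (As.gen Φ b) y, gen_circ_two]
    generalize Φ (a ⊗ₜ b) = z
    induction z using TensorProduct.induction_on with
    | zero => simp
    | add z z' h h' =>
      simp only [map_add, LinearMap.add_apply]
      exact add_mem h h'
    | tmul c d =>
      rw [mk_freeCircOne_tmul]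
      have := (As Φ).seq (l := 2) (m := 2) (n := n + 1) (p := 3) (q := n + 2) (r := n + 3)
        1 2 (by omega) (by omega) rfl (by omega) (by omega) (by omega) (by omega)
        (As.gen Φ c) (As.gen Φ d) y
      refine Eq.mp (congrArg (· ∈ _) this.symm) ?_
      exact circ_gen_mem_range_comb Φ _ c (ih (by omega) d)

/-- The class of a decorated tree. -/
noncomputable def treeClass {n : ℕ} (t : Trees A n) : (As Φ).obj n :=
  As.mk Φ n (freeMk K A n (Finsupp.single t 1))

theorem treeClass_graft {m n k : ℕ} (i : ℕ) (hi : 1 ≤ i ∧ i ≤ m) (h : k + 1 = m + n)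
    (t : Trees A m) (s : Trees A n) :
    treeClass Φ (Trees.graft i hi h t s) = (As Φ).circ i hi h (treeClass Φ t) (treeClass Φ s) := by
  have := linGraft_single K i hi h t s 1 1
  rw [mul_one] at this
  rw [treeClass, ← this]
  rfl

/-- A decorated tree, as a tree with `n` leaves. -/
def treeOf (t : BinaryTree A) {n : ℕ} (h : t.numLeaves = n) : Trees A n := ⟨t, h⟩

theorem treeClass_mem_range_comb (t : BinaryTree A) (n : ℕ) (h : t.numLeaves = n + 1) :
    treeClass Φ (treeOf t h) ∈ LinearMap.range (comb Φ n) := by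
  induction t generalizing n with
  | nil =>
    obtain rfl : n = 0 := by simpa [BinaryTree.numLeaves] using h.symm
    refine ⟨TensorPower.algebraMap₀ 1, ?_⟩
    rw [comb_algebraMap, one_smul]
    rfl
  | node a l r ihl ihr =>
    have hl := l.numLeaves_eq_numNodes_succ
    have hr := r.numLeaves_eq_numNodes_succ
    simp only [BinaryTree.numLeaves] at h
    have key : treeOf (.node a l r) h =
        Trees.graft 1 (by omega) (by omega)
          (Trees.graft (k := r.numNodes + 2) 2 (by omega) (by omega) (Trees.corolla a)
            (treeOf r hr))
          (treeOf l hl) := by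
      apply Subtype.ext
      simp [treeOf, Trees.graft, Trees.corolla, DecTree.graft, BinaryTree.numLeaves]
    rw [key, treeClass_graft, treeClass_graft]
    exact circ_one_mem_range_comb Φ _ (gen_circ_two_mem_range_comb Φ _ a (ihr _ hr)) (ihl _ hl)

theorem comb_surjective (n : ℕ) : Function.Surjective (comb Φ n) := by
  rw [← LinearMap.range_eq_top, eq_top_iff]
  rintro x -
  obtain ⟨x, rfl⟩ := Submodule.Quotient.mk_surjective _ x
  obtain ⟨x, rfl⟩ := Submodule.Quotient.mk_surjective _ x
  change As.mk Φ (n + 1) (freeMk K A (n + 1) x) ∈ _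
  induction x using Finsupp.induction_linear with
  | zero => exact zero_mem _
  | add x y hx hy => exact add_mem hx hy
  | single t c =>
    have : (Finsupp.single t c : Trees A (n + 1) →₀ K) = c • Finsupp.single t 1 := by simp
    rw [this]
    exact Submodule.smul_mem _ c (treeClass_mem_range_comb Φ t.1 n t.2)

variable {Φ}

theorem asEval_comb (hΦ : IsLinearEAS Φ) (n : ℕ) (x : ⨂[K]^n A) :
    asEval hΦ (n + 1) (comb Φ n x) = toTensorAlgebra x := by
  induction n with
  | zero =>
    obtain ⟨r, rfl⟩ := TensorPower.algebraMap₀.surjective x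
    rw [comb_algebraMap, map_smul, asEval_one, TensorPower.algebraMap₀_eq_smul_one, map_smul,
      TensorPower.toTensorAlgebra_gOne]
  | succ n ih =>
    obtain ⟨z, rfl⟩ := (consEquiv K A n).surjective x
    induction z using TensorProduct.induction_on with
    | zero => simp
    | add z z' h h' => simp only [map_add, h, h']
    | tmul a x =>
      rw [comb_consEquiv, asEval_circ, asEval_gen, ih, toTensorAlgebra_consEquiv, Nat.sub_self,
        splice_zero]

/-- The identification of `As_Φ(n + 1)` with the tensor power `A^{⊗n}`. -/
noncomputable def wordEquiv (hΦ : IsLinearEAS Φ) (n : ℕ) : (As Φ).obj (n + 1) ≃ₗ[K] ⨂[K]^n A :=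
  (LinearEquiv.ofBijective (comb Φ n)
    ⟨fun x y h => toTensorAlgebra_injective n <| by
      rw [← asEval_comb hΦ, ← asEval_comb hΦ, h], comb_surjective Φ n⟩).symm

theorem toTensorAlgebra_wordEquiv (hΦ : IsLinearEAS Φ) (n : ℕ) (z : (As Φ).obj (n + 1)) :
    toTensorAlgebra (wordEquiv hΦ n z) = asEval hΦ (n + 1) z := by
  rw [← asEval_comb hΦ]
  congr 1
  exact (wordEquiv hΦ n).symm_apply_apply z

theorem asEval_wordEquiv_symm (hΦ : IsLinearEAS Φ) (n : ℕ) (x : ⨂[K]^n A) :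
    asEval hΦ (n + 1) ((wordEquiv hΦ n).symm x) = toTensorAlgebra x := by
  rw [← toTensorAlgebra_wordEquiv, LinearEquiv.apply_symm_apply]

end PhiAssoc

/-- Under the identification `e n : As_Φ(n + 1) ≃ A^{⊗n}`, the word `a_k ⋯ a_1` is written in
reading order. For `i = s + 2`, the word is split as `a_k ⋯ a_i · a_{i-1} · a_{i-2} ⋯ a_1`, that is
`x · a · y` with `x`, `y` of lengths `r`, `s`. -/
theorem proposition3p5 {K : Type u} [Field K] {A : Type v} [AddCommGroup A] [Module K A]
    (Φ : A ⊗[K] A →ₗ[K] A ⊗[K] A) (hΦ : PhiAssoc.IsLinearEAS Φ) :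
    ∃ e : ∀ n : ℕ, (PhiAssoc.As Φ).obj (n + 1) ≃ₗ[K] ⨂[K]^n A,
      e 0 (PhiAssoc.As Φ).one = PiTensorProduct.tprod K Fin.elim0 ∧
      (∀ a : A, e 1 (PhiAssoc.As.gen Φ a) = PhiAssoc.letter K a) ∧
      (∀ (k l : ℕ) (x : ⨂[K]^k A) (b : ⨂[K]^l A),
        e (k + l) ((PhiAssoc.As Φ).circ 1 (by omega) (by omega) ((e k).symm x) ((e l).symm b)) =
          PhiAssoc.conc x b) ∧
      (∀ (r s l : ℕ) (x : ⨂[K]^r A) (a : A) (y : ⨂[K]^s A) (b : ⨂[K]^l A),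
        e (r + (1 + l) + s)
          ((PhiAssoc.As Φ).circ (s + 2) (by omega) (by omega)
            ((e (r + 1 + s)).symm
              (PhiAssoc.conc (PhiAssoc.conc x (PhiAssoc.letter K a)) y))
            ((e l).symm b)) =
          PhiAssoc.conc
            (PhiAssoc.conc x (PhiAssoc.sweep Φ l (PhiAssoc.conc (PhiAssoc.letter K a) b))) y) := by
  refine ⟨PhiAssoc.wordEquiv hΦ, ?_, fun a => ?_, fun k l x b => ?_, fun r s l x a y b => ?_⟩
  · apply PhiAssoc.toTensorAlgebra_injective
    rw [PhiAssoc.toTensorAlgebra_wordEquiv, PhiAssoc.asEval_one]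
    simp
  · apply PhiAssoc.toTensorAlgebra_injective
    rw [PhiAssoc.toTensorAlgebra_wordEquiv, PhiAssoc.asEval_gen, PhiAssoc.toTensorAlgebra_letter]
  · apply PhiAssoc.toTensorAlgebra_injective
    rw [PhiAssoc.toTensorAlgebra_wordEquiv, PhiAssoc.asEval_circ, PhiAssoc.asEval_wordEquiv_symm,
      PhiAssoc.asEval_wordEquiv_symm, Nat.sub_self, PhiAssoc.splice_zero,
      PhiAssoc.toTensorAlgebra_conc]
  · apply PhiAssoc.toTensorAlgebra_injective
    rw [PhiAssoc.toTensorAlgebra_wordEquiv, PhiAssoc.asEval_circ, PhiAssoc.asEval_wordEquiv_symm,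
      PhiAssoc.asEval_wordEquiv_symm]
    simp only [PhiAssoc.toTensorAlgebra_conc, PhiAssoc.toTensorAlgebra_letter,
      PhiAssoc.toTensorAlgebra_sweep]
    exact PhiAssoc.splice_mul_ι_mul Φ (PhiAssoc.toTensorAlgebra_mem y) _ _ a
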